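/- Let $\{0,1\}^n$ be the set of inputs. A concept is a function $c:\{0,1\}^n\to\{0,1\}$, and $C$ denotes a set of concepts. For a nonempty $C'\subseteq C$ put $$\gamma^{C'}=\max_{a\in\{0,1\}^n}\ \min_{b\in\{0,1\}}\frac{|\{c\in C':c(a)=b\}|}{|C'|},\qquad \hat\gamma^{C}=\min_{C'\subseteq C,\ |C'|\ge 2}\gamma^{C'}\quad(|C|\ge 2).$$ The quantum membership oracle is $QMQ_c:|x,b\rangle\mapsto|x,b\oplus c(x)\rangle$. A quantum exact learning algorithm for $C$ is a sequence of unitaries $U_0,QMQ_c,U_1,QMQ_c,\dots,QMQ_c,U_T$, where the $U_i$ do not depend on $c$ (and may act on extra workspace), applied to a fixed basis state, such that for every $c\in C$ a measurement of the final state yields with probability at least $2/3$ a Boolean circuit computing $c$; it makes $T$ queries. Logarithms are to base 2. A column flip on $S$ with respect to $K\subseteq\{0,1\}^n$ replaces every $c\in S$ by $c\oplus 1_K$. While it is in force, each oracle answer at an input in $K$ is inverted. The flip that makes $S$ 1-sensitive uses the set $K$ of those $x$ at which more concepts of $S$ yield 1 than 0. Algorithm 1 (input: a set $C$ of concepts).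 Start with $S=\mathcal I=\emptyset$. Repeat: flip $C\setminus S$ to make it 1-sensitive; let $a\notin\mathcal I$ be an input at which the largest number of the flipped concepts yield 1; add $a$ to $\mathcal I$, and add to $S$ all concepts of $C$ that (unflipped) yield 1 at $a$; until $|S|\ge|C|/2$. Output $\mathcal I$. Multi-target Grover search on $\mathcal I$. Let $m=\lceil\sqrt{|\mathcal I|}\rceil$. Do up to four rounds (in total at most $\frac92 m$ queries): choose $j\in\{0,\dots,m-1\}$ uniformly, apply $j$ Grover iterations to the uniform superposition over $\mathcal I$, and measure an input $a$. In every round but the last, check $a$ by a query and return it if the answer is 1. Return the result of the last round unchecked. Algorithm 2 (input: $C$ with $|C|\ge2$). Start with $S=C$ and repeat until $|S|=1$: flip $S$ to make it 1-sensitive; let $\mathcal I$ be the output of Algorithm 1 on the flipped $S$; repeat at most $\lceil\log(3\log|C|)\rceil$ times the Grover search on $\mathcal I$ followed by a classical query at its result $a$, stopping when the answer is 1. If an answer 1 was obtained, at $a$, keep in $S$ only the concepts with value 1 at $a$; otherwise keep only the concepts with value 0 at all inputs in $\mathcal I$. Undo the flip. At the end, output a circuit computing the sole concept in $S$. Theorem.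 There is an absolute constant $K>0$ such that for all $n$ and every set $C$ of concepts over $\{0,1\}^n$ with $|C|\ge2$, Algorithm 2 is a quantum exact learning algorithm for $C$: there is a sequence of unitaries and oracle calls as above which is a quantum exact learning algorithm for $C$, makes as many queries as Algorithm 2 makes in the worst case, and has on every oracle $c$ the same output distribution as Algorithm 2. Its number of queries is at most $$K\,\frac{\log|C|\,\log\log|C|}{\sqrt{\hat\gamma^{C}}}\quad\text{if }|C|\ge3,$$ and at most $K$ if $|C|=2$. -/

import Mathlib

open scoped Matrix

noncomputable section

namespace QuantumLearning

/-! ### Concepts and the combinatorial parameter -/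

/-- The domain `{0,1}ⁿ`. -/
abbrev Input (n : ℕ) : Type := Fin n → Bool

/-- A concept over `{0,1}ⁿ`.  A concept class over `{0,1}ⁿ` is a `Finset (Concept n)`. -/
abbrev Concept (n : ℕ) : Type := Input n → Bool

/-- `|{c ∈ C' : c(a) = b}|`. -/
def countAt {n : ℕ} (C' : Finset (Concept n)) (a : Input n) (b : Bool) : ℕ :=
  (C'.filter (fun c => c a = b)).card

/-- `γ_a^{C'} = min_b |{c ∈ C' : c(a) = b}| / |C'|`. -/
def gammaAt {n : ℕ} (C' : Finset (Concept n)) (a : Input n) : ℝ :=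
  min ((countAt C' a false : ℝ) / C'.card) ((countAt C' a true : ℝ) / C'.card)

/-- `γ^{C'} = max_a γ_a^{C'}` (a supremum over a finite nonempty index type). -/
def gamma {n : ℕ} (C' : Finset (Concept n)) : ℝ :=
  ⨆ a : Input n, gammaAt C' a

/-- `γ̂^C = min γ^{C'}` over the `C' ⊆ C` with `|C'| ≥ 2` (an infimum over a finite index type,
which is nonempty as soon as `|C| ≥ 2`). -/
def gammaHat {n : ℕ} (C : Finset (Concept n)) : ℝ :=
  ⨅ C' : {C' : Finset (Concept n) // C' ⊆ C ∧ 2 ≤ C'.card}, gamma C'.1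

/-! ### Boolean circuits -/

/-- A gate that reads some of `m` existing wires. -/
inductive Gate (m : ℕ) : Type
  | const (b : Bool) : Gate m
  | not (i : Fin m) : Gate m
  | and (i j : Fin m) : Gate m
  | or (i j : Fin m) : Gate m

/-- The value of a gate, given the values of the wires. -/
def Gate.eval {m : ℕ} : Gate m → (Fin m → Bool) → Bool
  | .const b, _ => b
  | .not i, v => !(v i)
  | .and i j, v => v i && v j
  | .or i j, v => v i || v j

/-- A Boolean circuit over `m` available wires: either one of the wires is declared to be the
output, or a gate is added, whose value becomes a new (last) wire.  Wires can be read any number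
of times.  A circuit with `n` inputs is a `BoolCircuit n`. -/
inductive BoolCircuit : ℕ → Type
  | output {m : ℕ} (i : Fin m) : BoolCircuit m
  | gate {m : ℕ} (g : Gate m) (rest : BoolCircuit (m + 1)) : BoolCircuit m

/-- The Boolean function computed by a circuit. -/
def BoolCircuit.eval {m : ℕ} : BoolCircuit m → (Fin m → Bool) → Bool
  | .output i, v => v i
  | .gate g rest, v => rest.eval (Fin.snoc v (g.eval v))

instance (n : ℕ) : Nonempty (BoolCircuit n) :=
  ⟨.gate (.const false) (.output (Fin.last n))⟩

open Classical in
/-- A representation of a circuit that computes the concept `c`. -/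
def circuitFor {n : ℕ} (c : Concept n) : BoolCircuit n :=
  Classical.epsilon (fun h : BoolCircuit n => h.eval = c)

/-! ### The quantum query model -/

/-- Computational basis states `|x, b, w⟩`: the query register `x`, the answer bit `b`, and a
workspace of dimension `d + 1`. -/
abbrev Basis (n d : ℕ) : Type := Input n × Bool × Fin (d + 1)

/-- The quantum membership oracle `QMQ_c : |x, b, w⟩ ↦ |x, b ⊕ c(x), w⟩`. -/
def QMQ {n : ℕ} (d : ℕ) (c : Concept n) : Matrix (Basis n d) (Basis n d) ℂ :=
  fun s t => if s = (t.1, xor t.2.1 (c t.1), t.2.2) then 1 else 0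

/-- `QMQ_c` applied twice is the identity. -/
theorem QMQ_mul_self {n : ℕ} (d : ℕ) (c : Concept n) : QMQ d c * QMQ d c = 1 := by
  ext s t
  rw [Matrix.mul_apply, Finset.sum_eq_single (t.1, xor t.2.1 (c t.1), t.2.2)]
  · simp [QMQ, Matrix.one_apply]
  · intro b _ hb
    have : QMQ d c b t = 0 := if_neg hb
    rw [this, mul_zero]
  · simp

theorem QMQ_conjTranspose {n : ℕ} (d : ℕ) (c : Concept n) : (QMQ d c)ᴴ = QMQ d c := by
  ext ⟨x, b, w⟩ ⟨y, b', w'⟩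
  simp only [QMQ, Matrix.conjTranspose_apply, Prod.mk.injEq, apply_ite star, star_one, star_zero]
  refine if_congr ⟨?_, ?_⟩ rfl rfl <;>
  · rintro ⟨rfl, h, rfl⟩
    refine ⟨rfl, ?_, rfl⟩
    rw [h]; simp

/-- `QMQ_c` is unitary. -/
def QMQUnitary {n : ℕ} (d : ℕ) (c : Concept n) : Matrix.unitaryGroup (Basis n d) ℂ :=
  ⟨QMQ d c, by
    rw [Matrix.mem_unitaryGroup_iff, Matrix.star_eq_conjTranspose, QMQ_conjTranspose,
      QMQ_mul_self]⟩

/-- A quantum query circuit `U₀, QMQ_c, U₁, QMQ_c, …, QMQ_c, U_T`, with `T = queries`.  The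
unitaries do not depend on `c`; only `U 0, …, U queries` are used. -/
structure QueryCircuit (n : ℕ) where
  /-- the number `T` of oracle invocations -/
  queries : ℕ
  /-- the workspace has dimension `work + 1` -/
  work : ℕ
  /-- the fixed unitary transformations -/
  U : ℕ → Matrix.unitaryGroup (Basis n work) ℂ

/-- The initial basis state `|0ⁿ, 0, 0⟩`. -/
def startState (n d : ℕ) : Basis n d → ℂ :=
  Pi.single ((fun _ => false), false, 0) 1

/-- The state right after `U t`, when the oracle is `QMQ_c`. -/
def QueryCircuit.state {n : ℕ} (A : QueryCircuit n) (c : Concept n) : ℕ → Basis n A.work → ℂ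
  | 0 => (A.U 0).1 *ᵥ startState n A.work
  | t + 1 => (A.U (t + 1)).1 *ᵥ (QMQ A.work c *ᵥ A.state c t)

/-- The probability that measuring the final state in the computational basis yields `z`. -/
def QueryCircuit.measure {n : ℕ} (A : QueryCircuit n) (c : Concept n) (z : Basis n A.work) : ℝ :=
  ‖A.state c A.queries z‖ ^ 2

/-- A quantum query circuit whose measurement outcomes represent Boolean circuits. -/
structure QuantumLearner (n : ℕ) extends QueryCircuit n where
  /-- the hypothesis represented by a measurement outcome -/
  out : Basis n work → BoolCircuit n

open Classical in
/-- The probability that the learner outputs exactly the circuit `h` on target `c`. -/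
def QuantumLearner.prob {n : ℕ} (A : QuantumLearner n) (c : Concept n) (h : BoolCircuit n) : ℝ :=
  ∑ z, if A.out z = h then A.measure c z else 0

open Classical in
/-- Quantum exact learning algorithm for `C`: for every target `c ∈ C`, with probability at least
`2/3` the outcome represents a circuit that agrees with `c` on all inputs. -/
def QuantumLearner.IsExactLearnerFor {n : ℕ} (A : QuantumLearner n)
    (C : Finset (Concept n)) : Prop :=
  ∀ c ∈ C, 2 / 3 ≤ ∑ z, if (∀ x, (A.out z).eval x = c x) then A.measure c z else 0

/-! ### Adaptive procedures with intermediate measurements -/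

/-- Adaptive procedures: return a value, make a uniform random choice from `m + 1` options, make a
classical query, or run a quantum query circuit (on fresh registers) and measure; the continuation
depends on the choice, the answer, or the outcome. -/
inductive Procedure (n : ℕ) (α : Type) : Type
  | ret (a : α) : Procedure n α
  | rand (m : ℕ) (k : Fin (m + 1) → Procedure n α) : Procedure n α
  | query (x : Input n) (k : Bool → Procedure n α) : Procedure n α
  | run (A : QueryCircuit n) (k : Basis n A.work → Procedure n α) : Procedure n α

namespace Procedure

variable {n : ℕ} {α β : Type}

/-- Sequential composition. -/
def bind : Procedure n α → (α → Procedure n β) → Procedure n β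
  | ret a, f => f a
  | rand m k, f => rand m (fun i => (k i).bind f)
  | query x k, f => query x (fun b => (k b).bind f)
  | run A k, f => run A (fun z => (k z).bind f)

open Classical in
/-- The probability that the procedure outputs `a` when the oracle is `c`. -/
def prob (c : Concept n) : Procedure n α → α → ℝ
  | ret a', a => if a' = a then 1 else 0
  | rand m k, a => (∑ i, prob c (k i) a) / (m + 1)
  | query x k, a => prob c (k (c x)) a
  | run A k, a => ∑ z, A.measure c z * prob c (k z) a

/-- The number of oracle queries, in the worst case over all branches. -/
def queries : Procedure n α → ℕ
  | ret _ => 0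
  | rand _ k => Finset.univ.sup (fun i => (k i).queries)
  | query _ k => 1 + Finset.univ.sup (fun b => (k b).queries)
  | run A k => A.queries + Finset.univ.sup (fun z => (k z).queries)

end Procedure

/-! ### Column flips -/

/-- The indicator function of a set of inputs. -/
def indicator {n : ℕ} (K : Finset (Input n)) : Concept n := fun x => decide (x ∈ K)

/-- The concept `c` with its values on `K` flipped. -/
def flipConcept {n : ℕ} (K : Finset (Input n)) (c : Concept n) : Concept n :=
  fun x => xor (c x) (indicator K x)

/-- Flip the columns `K` of the matrix of a set of concepts. -/
def columnFlip {n : ℕ} (K : Finset (Input n)) (S : Finset (Concept n)) : Finset (Concept n) :=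
  S.image (flipConcept K)

/-- The inputs at which more concepts of `S` yield `1` than `0`: flipping exactly these columns
makes `S` 1-sensitive. -/
def flipSet {n : ℕ} (S : Finset (Concept n)) : Finset (Input n) :=
  Finset.univ.filter (fun x => countAt S x false < countAt S x true)

/-- Run a circuit on the simulated oracle in which the answers on `K` are inverted: every answer
of the true oracle is followed by `|x, b, w⟩ ↦ |x, b ⊕ [x ∈ K], w⟩`. -/
def QueryCircuit.simulate {n : ℕ} (K : Finset (Input n)) (A : QueryCircuit n) :
    QueryCircuit n where
  queries := A.queries
  work := A.work
  U
    | 0 => A.U 0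
    | t + 1 => A.U (t + 1) * QMQUnitary A.work (indicator K)

/-- Run a procedure on the simulated oracle in which the answers on `K` are inverted. -/
def Procedure.simulate {n : ℕ} {α : Type} (K : Finset (Input n)) :
    Procedure n α → Procedure n α
  | .ret a => .ret a
  | .rand m k => .rand m (fun i => (k i).simulate K)
  | .query x k => .query x (fun b => (k (xor b (indicator K x))).simulate K)
  | .run A k => .run (A.simulate K) (fun z => (k z).simulate K)

/-! ### The greedy construction of the search set -/

/-- An element of `X` at which `f` is largest. -/
def argmaxOn {α : Type} (X : Finset α) (hX : X.Nonempty) (f : α → ℕ) : α :=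
  (X.exists_max_image f hX).choose

/-- The repeat loop of the greedy construction, with a bound on the number of rounds.  `S` is the
set of covered concepts and `I` the set of chosen inputs. -/
def greedyLoop {n : ℕ} (C : Finset (Concept n)) :
    ℕ → Finset (Concept n) → Finset (Input n) → Finset (Input n)
  | 0, _, I => I
  | k + 1, S, I =>
    if hX : (Finset.univ \ I).Nonempty then
      let R := columnFlip (flipSet (C \ S)) (C \ S)
      let a := argmaxOn (Finset.univ \ I) hX (fun x => countAt R x true)
      let I' := insert a I
      let S' := S ∪ C.filter (fun c => c a = true)
      if C.card ≤ 2 * S'.card then I' else greedyLoop C k S' I'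
    else I

/-- The greedy construction of a set of inputs satisfying the semi-rich row condition for `C`.
Each round adds a new input, so `2ⁿ` rounds are all that there can be. -/
def greedyInputs {n : ℕ} (C : Finset (Concept n)) : Finset (Input n) :=
  greedyLoop C (Fintype.card (Input n)) ∅ ∅

/-! ### Multi-target Grover search on a subset of the inputs -/

/-- The Householder reflection `1 - 2 w w* / (w* w)` (the identity for `w = 0`). -/
def reflection {ι : Type} [Fintype ι] [DecidableEq ι] (w : ι → ℂ) : Matrix ι ι ℂ :=
  1 - (2 / (star w ⬝ᵥ w)) • Matrix.vecMulVec w (star w)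

theorem reflection_mem_unitaryGroup {ι : Type} [Fintype ι] [DecidableEq ι] (w : ι → ℂ) :
    reflection w ∈ Matrix.unitaryGroup ι ℂ := by
  have hs : star (star w ⬝ᵥ w) = star w ⬝ᵥ w := by
    exact (Matrix.star_dotProduct w w).symm
  have hsq : Matrix.vecMulVec w (star w) * Matrix.vecMulVec w (star w) =
      (star w ⬝ᵥ w) • Matrix.vecMulVec w (star w) := by
    rw [Matrix.vecMulVec_mul_vecMulVec]
    ext i j
    simp [Matrix.vecMulVec_apply]
    ring
  have hstar : star (reflection w) = reflection w := by
    rw [reflection, Matrix.star_eq_conjTranspose, Matrix.conjTranspose_sub,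
      Matrix.conjTranspose_one, Matrix.conjTranspose_smul, Matrix.conjTranspose_vecMulVec,
      star_star, star_div₀, hs]
    simp
  rw [Matrix.mem_unitaryGroup_iff, hstar]
  by_cases h0 : star w ⬝ᵥ w = 0
  · simp [reflection, h0]
  · rw [reflection, sub_mul, one_mul, Matrix.smul_mul, Matrix.mul_sub,
      mul_one, Matrix.mul_smul, hsq, smul_sub, smul_smul, smul_smul]
    have : (2 / (star w ⬝ᵥ w)) * (2 / (star w ⬝ᵥ w)) * (star w ⬝ᵥ w) =
        2 / (star w ⬝ᵥ w) + 2 / (star w ⬝ᵥ w) := by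
      field_simp; norm_num
    rw [this, add_smul]
    abel

/-- The reflection as an element of the unitary group. -/
def reflectionUnitary {ι : Type} [Fintype ι] [DecidableEq ι] (w : ι → ℂ) :
    Matrix.unitaryGroup ι ℂ :=
  ⟨reflection w, reflection_mem_unitaryGroup w⟩

/-- The state `|I|^{-1/2} ∑_{x ∈ I} |x⟩ ⊗ (|0⟩ - |1⟩)/√2`. -/
def groverStart {n : ℕ} (I : Finset (Input n)) : Basis n 0 → ℂ :=
  fun z => if z.1 ∈ I then ((if z.2.1 then -1 else 1) / Real.sqrt (2 * I.card) : ℝ) else 0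

/-- `j` Grover iterations on the set `I`: `U₀` is a reflection which takes the initial basis state
to `ψ = groverStart I`; each iteration is one query (which changes the sign of the marked inputs,
as the answer bit is in the state `(|0⟩ - |1⟩)/√2`) followed by the inversion about the mean
`2 ψ ψ* - 1`. -/
def groverCircuit {n : ℕ} (I : Finset (Input n)) (j : ℕ) : QueryCircuit n where
  queries := j
  work := 0
  U
    | 0 => reflectionUnitary (startState n 0 - groverStart I)
    | _ + 1 => -reflectionUnitary (groverStart I)

/-- One round of the search with an unknown number of targets: pick `j < ⌈√|I|⌉` uniformly at
random, do `j` Grover iterations, and measure the query register. -/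
def groverRound {n : ℕ} (I : Finset (Input n)) : Procedure n (Input n) :=
  .rand (⌈Real.sqrt I.card⌉₊ - 1) (fun j => .run (groverCircuit I j) (fun z => .ret z.1))

/-- `r + 1` rounds; the result of a round is returned if it is a target, and otherwise the next
round is run.  The result of the last round is returned unchecked. -/
def groverRounds {n : ℕ} (I : Finset (Input n)) : ℕ → Procedure n (Input n)
  | 0 => groverRound I
  | r + 1 => (groverRound I).bind (fun a =>
      .query a (fun b => if b then .ret a else groverRounds I r))

/-- The multi-target Grover search on `I`, with four rounds.  Each round with its check takes at
most `⌈√|I|⌉` queries, so the search stays within the budget of `(9/2) ⌈√|I|⌉` queries. -/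
def groverSearch {n : ℕ} (I : Finset (Input n)) : Procedure n (Input n) :=
  groverRounds I 3

/-! ### The learning algorithm -/

/-- The inner loop: up to `r` times, search on `I` and check the result with a classical query;
stop with `some a` as soon as a check succeeds. -/
def innerLoop {n : ℕ} (I : Finset (Input n)) : ℕ → Procedure n (Option (Input n))
  | 0 => .ret none
  | r + 1 => (groverSearch I).bind (fun a =>
      .query a (fun b => if b then .ret (some a) else innerLoop I r))

/-- An element of `S` (the only one, if `|S| = 1`). -/
def soleConcept {n : ℕ} (S : Finset (Concept n)) : Concept n :=
  if h : S.Nonempty then h.choose else fun _ => false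

/-- The outer loop, with `r` repetitions of the inner loop and a bound on the number of rounds. -/
def outerLoop {n : ℕ} (r : ℕ) : ℕ → Finset (Concept n) → Procedure n (BoolCircuit n)
  | 0, S => .ret (circuitFor (soleConcept S))
  | k + 1, S =>
    if S.card ≤ 1 then .ret (circuitFor (soleConcept S))
    else
      let K := flipSet S
      let S' := columnFlip K S
      let I := greedyInputs S'
      ((innerLoop I r).simulate K).bind (fun res =>
        match res with
        | some a => outerLoop r k (columnFlip K (S'.filter (fun c => c a = true)))
        | none => outerLoop r k (columnFlip K (S'.filter (fun c => ∀ x ∈ I, c x = false))))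

/-- The quantum exact learning algorithm for the class `C`.  The inner loop stops when its counter
reaches `log (3 log |C|)`.  Each round of the outer loop makes `S` smaller, so the bound `|C|` on
their number is never reached before `|S| ≤ 1`. -/
def learningAlgorithm {n : ℕ} (C : Finset (Concept n)) : Procedure n (BoolCircuit n) :=
  outerLoop ⌈Real.logb 2 (3 * Real.logb 2 C.card)⌉₊ C.card C

end QuantumLearning

end

noncomputable section

namespace QuantumLearning

/-! ### The oracle and the measurement -/

/-! Three estimates carry the query bound and the success probability; a fourth argument removes the
intermediate measurements.

Halving (`card_nextCandidates_le`). After the flip, an answer 1 at any input leaves a minority of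
the candidates, and rejecting all of the greedy set `I` leaves only the uncovered ones, at most
half. This holds in every branch, whether or not the search was right, so at most log|C| rounds
occur.

Small search sets (`greedyLoop_spec`). With γ the parameter of `C`, some input splits the uncovered
concepts into two parts of fraction at least γ each. While less than half of the concepts are
covered, each greedy choice thus covers at least γ|C|/2 new ones, which gives |I| ≤ 1 + 1/γ. One
Grover search on `I` then costs O(1/√γ) queries.

Error (`expect_innerLoop_error_le`, `expect_outerLoop_error_le`). For a random number of iterations,
the averaged success probability of a Grover round is at least 1/4 as soon as a target exists
(`sum_sin_sq_ge`). Four rounds miss with probability at most (3/4)^4 < 1/2, so r searches miss with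
probability at most 2^(-r). Only such a miss can discard the true concept. The union bound over
log|C| rounds gives log|C| · 2^(-r), and r = ⌈log(3 log|C|)⌉ makes this at most 1/3.

Deferred measurement (`QueryCircuit.exists_sequential`, `Procedure.exists_queryCircuit`). A
measurement followed by an adaptive continuation is replaced by a unitary that moves the outcome
into a block label, with the continuations running in orthogonal blocks. Branches that use fewer
queries are padded, so the worst-case count is met exactly and the output distribution is unchanged.
-/

theorem QMQ_mulVec {n d : ℕ} (c : Concept n) (f : Basis n d → ℂ) (z : Basis n d) :
    (QMQ d c *ᵥ f) z = f (z.1, xor z.2.1 (c z.1), z.2.2) := by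
  rw [Matrix.mulVec, dotProduct, Finset.sum_eq_single (z.1, xor z.2.1 (c z.1), z.2.2)]
  · simp [QMQ]
  · rintro ⟨x, b, w⟩ _ hb
    have : QMQ d c z (x, b, w) = 0 := by
      refine if_neg ?_
      rintro rfl
      exact hb (by simp)
    rw [this, zero_mul]
  · simp

theorem sum_norm_sq_mulVec {ι : Type} [Fintype ι] [DecidableEq ι] {U : Matrix ι ι ℂ}
    (hU : U ∈ Matrix.unitaryGroup ι ℂ) (f : ι → ℂ) :
    ∑ z, ‖(U *ᵥ f) z‖ ^ 2 = ∑ z, ‖f z‖ ^ 2 := by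
  have key : ∀ g : ι → ℂ, ((∑ z, ‖g z‖ ^ 2 : ℝ) : ℂ) = star g ⬝ᵥ g := by
    intro g
    simp [dotProduct, Complex.conj_mul']
  have h : star (U *ᵥ f) ⬝ᵥ (U *ᵥ f) = star f ⬝ᵥ f := by
    rw [Matrix.star_mulVec, Matrix.dotProduct_mulVec, Matrix.vecMul_vecMul,
      ← Matrix.star_eq_conjTranspose, Matrix.mem_unitaryGroup_iff'.mp hU, Matrix.vecMul_one]
  exact_mod_cast (key _).trans (h.trans (key _).symm)

theorem QueryCircuit.sum_norm_sq_state {n : ℕ} (A : QueryCircuit n) (c : Concept n) (t : ℕ) :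
    ∑ z, ‖A.state c t z‖ ^ 2 = 1 := by
  induction t with
  | zero =>
    rw [QueryCircuit.state, sum_norm_sq_mulVec (A.U 0).2, startState,
      Finset.sum_eq_single ((fun _ => false), false, 0)]
    · simp
    · intro b _ hb
      simp [Pi.single_eq_of_ne hb]
    · simp
  | succ t ih =>
    rw [QueryCircuit.state, sum_norm_sq_mulVec (A.U (t + 1)).2]
    exact (sum_norm_sq_mulVec (QMQUnitary A.work c).2 _).trans ih

theorem QueryCircuit.sum_measure {n : ℕ} (A : QueryCircuit n) (c : Concept n) :
    ∑ z, A.measure c z = 1 :=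
  A.sum_norm_sq_state c A.queries

theorem QueryCircuit.measure_nonneg {n : ℕ} (A : QueryCircuit n) (c : Concept n)
    (z : Basis n A.work) : 0 ≤ A.measure c z := by
  unfold QueryCircuit.measure; positivity

/-- The oracles of two concepts compose to the oracle of their pointwise xor, so inverting each
answer on `K` is the same as querying the flipped concept. Everything proved about a search on
flipped candidates transfers to the true oracle this way. -/
theorem QueryCircuit.state_simulate {n : ℕ} (A : QueryCircuit n) (K : Finset (Input n))
    (c : Concept n) (t : ℕ) :
    (A.simulate K).state c t = A.state (flipConcept K c) t := by
  induction t with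
  | zero => rfl
  | succ t ih =>
    rw [QueryCircuit.state, QueryCircuit.state, ih]
    change ((A.U (t + 1)).1 * QMQ A.work (indicator K)) *ᵥ
      (QMQ A.work c *ᵥ A.state (flipConcept K c) t) = _
    rw [← Matrix.mulVec_mulVec]
    congr 1
    ext z
    rw [QMQ_mulVec]
    refine (QMQ_mulVec c _ _).trans ?_
    rw [QMQ_mulVec]
    simp only [flipConcept, Bool.xor_assoc, Bool.xor_comm (c z.1)]

/-! ### Expectations of the output of a procedure -/

namespace Procedure

variable {n : ℕ} {α β : Type}

/-- The expectation of `g` at the output of the procedure when the oracle is `c`. -/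
def expect (c : Concept n) : Procedure n α → (α → ℝ) → ℝ
  | ret a, g => g a
  | rand m k, g => (∑ i, expect c (k i) g) / (m + 1)
  | query x k, g => expect c (k (c x)) g
  | run A k, g => ∑ z, A.measure c z * expect c (k z) g

open Classical in
theorem prob_eq_expect (c : Concept n) (P : Procedure n α) (a : α) :
    P.prob c a = P.expect c (fun a' => if a' = a then 1 else 0) := by
  induction P with
  | ret a' => rfl
  | rand m k ih => simp only [prob, expect, ih]
  | query x k ih => simp only [prob, expect, ih]
  | run A k ih => simp only [prob, expect, ih]

/-- The law of total expectation. Expectations of arbitrary functions, rather than `prob` alone, are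
tracked because they compose in this way. -/
theorem expect_bind (c : Concept n) (P : Procedure n α) (f : α → Procedure n β) (g : β → ℝ) :
    (P.bind f).expect c g = P.expect c (fun a => (f a).expect c g) := by
  induction P with
  | ret a' => rfl
  | rand m k ih => simp only [bind, expect, ih]
  | query x k ih => simp only [bind, expect, ih]
  | run A k ih => simp only [bind, expect, ih]

theorem expect_mono (c : Concept n) (P : Procedure n α) {g h : α → ℝ} (H : ∀ a, g a ≤ h a) :
    P.expect c g ≤ P.expect c h := by
  induction P with
  | ret a' => exact H a'
  | rand m k ih =>
    simp only [expect]
    gcongr with i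
    exact ih i
  | query x k ih => exact ih _
  | run A k ih =>
    simp only [expect]
    refine Finset.sum_le_sum fun z _ => mul_le_mul_of_nonneg_left (ih z) (A.measure_nonneg c z)

theorem expect_const (c : Concept n) (P : Procedure n α) (r : ℝ) :
    P.expect c (fun _ => r) = r := by
  induction P with
  | ret a' => rfl
  | rand m k ih =>
    simp only [expect, ih]
    rw [Finset.sum_const, Finset.card_univ, Fintype.card_fin, nsmul_eq_mul]
    push_cast
    field_simp
  | query x k ih => exact ih _
  | run A k ih => simp only [expect, ih, ← Finset.sum_mul, A.sum_measure, one_mul]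

theorem expect_add (c : Concept n) (P : Procedure n α) (g h : α → ℝ) :
    P.expect c (fun a => g a + h a) = P.expect c g + P.expect c h := by
  induction P with
  | ret a' => rfl
  | rand m k ih => simp only [expect, ih, Finset.sum_add_distrib, add_div]
  | query x k ih => exact ih _
  | run A k ih => simp only [expect, ih, mul_add, Finset.sum_add_distrib]

theorem expect_mul_const (c : Concept n) (P : Procedure n α) (g : α → ℝ) (r : ℝ) :
    P.expect c (fun a => g a * r) = P.expect c g * r := by
  induction P with
  | ret a' => rfl
  | rand m k ih => simp only [expect, ih, ← Finset.sum_mul]; ring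
  | query x k ih => exact ih _
  | run A k ih => simp only [expect, ih, Finset.sum_mul, mul_assoc]

theorem expect_one_sub (c : Concept n) (P : Procedure n α) (g : α → ℝ) :
    P.expect c (fun a => 1 - g a) = 1 - P.expect c g := by
  have h := P.expect_add c (fun a => 1 - g a) g
  simp only [sub_add_cancel, expect_const] at h
  linarith

theorem expect_simulate (K : Finset (Input n)) (c : Concept n) (P : Procedure n α) (g : α → ℝ) :
    (P.simulate K).expect c g = P.expect (flipConcept K c) g := by
  induction P with
  | ret a' => rfl
  | rand m k ih => simp only [simulate, expect, ih]
  | query x k ih => simp only [simulate, expect, ih]; rfl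
  | run A k ih =>
    refine Finset.sum_congr rfl fun z _ => congrArg₂ (· * ·) ?_ (ih z)
    exact congrArg (fun f => ‖f z‖ ^ 2) (A.state_simulate K c A.queries)

/-! ### Query counts -/

theorem queries_simulate (K : Finset (Input n)) (P : Procedure n α) :
    (P.simulate K).queries = P.queries := by
  induction P with
  | ret a' => rfl
  | rand m k ih => simp only [simulate, queries, ih]
  | query x k ih =>
    simp only [simulate, queries, ih]
    congr 1
    -- The map `b ↦ xor b (indicator K x)` is an involution of `Bool`, so it only permutes the
    -- branches under the supremum.
    apply le_antisymm <;> refine Finset.sup_le fun b _ => ?_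
    · exact Finset.le_sup (f := fun b => (k b).queries) (Finset.mem_univ _)
    · have := Finset.le_sup (f := fun b => (k (xor b (indicator K x))).queries)
        (Finset.mem_univ (xor b (indicator K x)))
      simpa using this
  | run A k ih =>
    exact congrArg (A.queries + ·) (Finset.sup_congr rfl fun z _ => ih z)

theorem queries_bind_le (P : Procedure n α) (f : α → Procedure n β) {q : ℕ}
    (hf : ∀ a, (f a).queries ≤ q) : (P.bind f).queries ≤ P.queries + q := by
  induction P with
  | ret a' => simpa [bind, queries] using hf a'
  | rand m k ih =>
    simp only [bind, queries]
    refine Finset.sup_le fun i _ => (ih i).trans ?_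
    gcongr
    exact Finset.le_sup (f := fun i => (k i).queries) (Finset.mem_univ i)
  | query x k ih =>
    simp only [bind, queries]
    rw [add_assoc]
    gcongr
    refine Finset.sup_le fun i _ => (ih i).trans ?_
    gcongr
    exact Finset.le_sup (f := fun i => (k i).queries) (Finset.mem_univ i)
  | run A k ih =>
    simp only [bind, queries]
    rw [add_assoc]
    gcongr
    refine Finset.sup_le fun i _ => (ih i).trans ?_
    gcongr
    exact Finset.le_sup (f := fun i => (k i).queries) (Finset.mem_univ i)

end Procedure

/-! ### Every Boolean function has a circuit -/

/-- The concept `f` can be computed with additional gates: whenever the inputs are among the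
values `w` of the wires, a circuit for `t` exists as soon as one exists for all extensions of the
wires among which is `f`. -/
def Computable {n : ℕ} (f : Concept n) : Prop :=
  ∀ (t : Concept n) (m : ℕ) (w : Input n → Fin m → Bool),
    (∀ i : Fin n, ∃ j, ∀ x, w x j = x i) →
    (∀ (m' : ℕ) (w' : Input n → Fin m' → Bool), (∀ i, ∃ j, ∀ x, w' x j = w x i) →
      (∃ j, ∀ x, w' x j = f x) → ∃ h : BoolCircuit m', ∀ x, h.eval (w' x) = t x) →
    ∃ h : BoolCircuit m, ∀ x, h.eval (w x) = t x

/-- A `BoolCircuit` grows only by new last wires and ends with its output, so circuits are not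
plugged into each other directly. `Computable` is therefore in continuation-passing style, and this
is its basic step: old wires survive as `castSucc`, and the new value sits on `Fin.last m`. -/
theorem exists_circuit_of_gate {n m : ℕ} {t : Concept n} (w : Input n → Fin m → Bool)
    (f : Concept n) (g : Gate m) (hg : ∀ x, g.eval (w x) = f x)
    (H : ∀ (m' : ℕ) (w' : Input n → Fin m' → Bool), (∀ i, ∃ j, ∀ x, w' x j = w x i) →
      (∃ j, ∀ x, w' x j = f x) → ∃ h : BoolCircuit m', ∀ x, h.eval (w' x) = t x) :
    ∃ h : BoolCircuit m, ∀ x, h.eval (w x) = t x := by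
  obtain ⟨h, hh⟩ := H (m + 1) (fun x => Fin.snoc (w x) (g.eval (w x)))
    (fun i => ⟨i.castSucc, fun x => by simp [Fin.snoc]⟩)
    ⟨Fin.last m, fun x => by simp [Fin.snoc, hg]⟩
  exact ⟨.gate g h, hh⟩

theorem Computable.const {n : ℕ} (b : Bool) : Computable (fun _ : Input n => b) :=
  fun _ _ w _ H => exists_circuit_of_gate w _ (.const b) (fun _ => rfl) H

theorem Computable.proj {n : ℕ} (i : Fin n) : Computable (fun x : Input n => x i) :=
  fun _ m w hw H => H m w (fun i => ⟨i, fun _ => rfl⟩) (hw i)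

theorem Computable.not {n : ℕ} {f : Concept n} (hf : Computable f) :
    Computable (fun x => !(f x)) := by
  intro t m w hw H
  refine hf t m w hw fun m' w' hw' ⟨j, hj⟩ => ?_
  refine exists_circuit_of_gate w' (fun x => !(f x)) (.not j) (fun x => ?_)
    fun m'' w'' hw'' hf'' => ?_
  · simp [Gate.eval, hj]
  · refine H m'' w'' (fun i => ?_) hf''
    obtain ⟨j, hj⟩ := hw' i
    obtain ⟨k, hk⟩ := hw'' j
    exact ⟨k, fun x => (hk x).trans (hj x)⟩

theorem Computable.and {n : ℕ} {f g : Concept n} (hf : Computable f) (hg : Computable g) :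
    Computable (fun x => f x && g x) := by
  intro t m w hw H
  refine hf t m w hw fun m₁ w₁ hw₁ ⟨j, hj⟩ => ?_
  refine hg t m₁ w₁ (fun i => ?_) fun m₂ w₂ hw₂ ⟨k, hk⟩ => ?_
  · obtain ⟨a, ha⟩ := hw i
    obtain ⟨b, hb⟩ := hw₁ a
    exact ⟨b, fun x => (hb x).trans (ha x)⟩
  · obtain ⟨j', hj'⟩ := hw₂ j
    refine exists_circuit_of_gate w₂ (fun x => f x && g x) (.and j' k) (fun x => ?_)
      fun m₃ w₃ hw₃ hf₃ => H m₃ w₃ (fun i => ?_) hf₃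
    · simp [Gate.eval, hj', hj, hk]
    · obtain ⟨a, ha⟩ := hw₁ i
      obtain ⟨b, hb⟩ := hw₂ a
      obtain ⟨d, hd⟩ := hw₃ b
      exact ⟨d, fun x => (hd x).trans ((hb x).trans (ha x))⟩

theorem Computable.or {n : ℕ} {f g : Concept n} (hf : Computable f) (hg : Computable g) :
    Computable (fun x => f x || g x) := by
  have := (hf.not.and hg.not).not
  simpa using this

theorem Computable.of_forall_eq {n : ℕ} (y : Input n) (s : Finset (Fin n)) :
    Computable (fun x => decide (∀ i ∈ s, x i = y i)) := by
  induction s using Finset.induction_on with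
  | empty => simpa using Computable.const (n := n) true
  | insert i s _ ih =>
    have h : Computable (fun x : Input n => decide (x i = y i)) := by
      cases y i with
      | false => simpa using (Computable.proj i).not
      | true => simpa using Computable.proj i
    simpa [Bool.decide_and] using h.and ih

/-- Disjunctive normal form: an or over the points of the set, each recognised by a conjunction of
literals. -/
theorem Computable.of_mem {n : ℕ} (s : Finset (Input n)) :
    Computable (fun x => decide (x ∈ s)) := by
  induction s using Finset.induction_on with
  | empty => simpa using Computable.const (n := n) false
  | insert y s _ ih =>
    have h : Computable (fun x : Input n => decide (x = y)) := by
      simpa [funext_iff] using Computable.of_forall_eq y Finset.univ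
    simpa [Bool.decide_or] using h.or ih

theorem computable_all {n : ℕ} (f : Concept n) : Computable f := by
  simpa using Computable.of_mem (Finset.univ.filter (fun x => f x = true))

theorem exists_circuit {n : ℕ} (f : Concept n) : ∃ h : BoolCircuit n, h.eval = f := by
  obtain ⟨h, hh⟩ := computable_all f f n (fun x => x) (fun i => ⟨i, fun _ => rfl⟩)
    (fun m' w' _ ⟨j, hj⟩ => ⟨.output j, hj⟩)
  exact ⟨h, funext hh⟩

theorem circuitFor_eval {n : ℕ} (c : Concept n) : (circuitFor c).eval = c :=
  Classical.epsilon_spec (exists_circuit c)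

/-! ### Reflections -/

theorem reflection_mulVec {ι : Type} [Fintype ι] [DecidableEq ι] (w f : ι → ℂ) :
    reflection w *ᵥ f = f - (2 / (star w ⬝ᵥ w) * (star w ⬝ᵥ f)) • w := by
  rw [reflection, Matrix.sub_mulVec, Matrix.one_mulVec, Matrix.smul_mulVec,
    Matrix.vecMulVec_mulVec]
  ext i
  simp only [Pi.sub_apply, Pi.smul_apply, smul_eq_mul, MulOpposite.smul_eq_mul_unop,
    MulOpposite.unop_op]
  ring

theorem star_dotProduct_self {ι : Type} [Fintype ι] (f : ι → ℂ) :
    star f ⬝ᵥ f = ((∑ z, ‖f z‖ ^ 2 : ℝ) : ℂ) := by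
  simp [dotProduct, Complex.conj_mul']

/-- A Householder reflection in the difference of two unit vectors exchanges them provided that
their inner product is real, which is what `hr` ensures. This single construction prepares every
initial state used here. -/
theorem reflection_startState_sub {n d : ℕ} (ψ : Basis n d → ℂ) (hψ : ∑ z, ‖ψ z‖ ^ 2 = 1)
    (hr : star (ψ ((fun _ => false), false, 0)) = ψ ((fun _ => false), false, 0)) :
    reflection (startState n d - ψ) *ᵥ startState n d = ψ := by
  set e := startState n d with he
  set a := ψ ((fun _ => false), false, 0) with ha
  have h1 : star e ⬝ᵥ e = 1 := by
    rw [he, startState, dotProduct_single]; simp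
  have h2 : star ψ ⬝ᵥ ψ = 1 := by rw [star_dotProduct_self, hψ]; simp
  have h3 : star ψ ⬝ᵥ e = a := by
    rw [he, startState, dotProduct_single]; simpa using hr
  have h4 : star e ⬝ᵥ ψ = a := by
    rw [he, startState, ← Pi.single_star, single_dotProduct]; simp [ha]
  have h5 : star (e - ψ) ⬝ᵥ e = 1 - a := by
    rw [star_sub, sub_dotProduct, h1, h3]
  have h6 : star (e - ψ) ⬝ᵥ (e - ψ) = 2 * (1 - a) := by
    rw [dotProduct_sub, h5, star_sub, sub_dotProduct, h2, h4]; ring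
  rw [reflection_mulVec, h5, h6]
  -- Inner product 1 between unit vectors forces them to be equal; the reflection vector is then 0
  -- and nothing moves.
  by_cases h : 1 - a = 0
  · have : e - ψ = 0 := by
      rw [h, mul_zero, star_dotProduct_self] at h6
      have h7 := (Finset.sum_eq_zero_iff_of_nonneg (fun z _ => by positivity)).mp
        (Complex.ofReal_eq_zero.mp h6)
      ext z
      simpa using h7 z (Finset.mem_univ z)
    rw [this, smul_zero, sub_zero]
    exact sub_eq_zero.mp this
  · have : 2 / (2 * (1 - a)) * (1 - a) = 1 := by field_simp
    rw [this, one_smul]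
    abel

/-! ### The states of Grover search -/

/-- The state with real amplitudes `h` on the inputs and answer register `|0⟩ - |1⟩`. -/
def phaseState {n : ℕ} (h : Input n → ℝ) : Basis n 0 → ℂ :=
  fun z => (((if z.2.1 then -1 else 1) * h z.1 : ℝ) : ℂ)

theorem sum_basis_zero {n : ℕ} {M : Type} [AddCommMonoid M] (f : Basis n 0 → M) :
    ∑ z, f z = ∑ x, (f (x, true, 0) + f (x, false, 0)) := by
  rw [Fintype.sum_prod_type]
  refine Finset.sum_congr rfl fun x _ => ?_
  rw [Fintype.sum_prod_type]
  simp

theorem star_phaseState_dotProduct {n : ℕ} (g h : Input n → ℝ) :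
    star (phaseState g) ⬝ᵥ phaseState h = ((2 * ∑ x, g x * h x : ℝ) : ℂ) := by
  rw [dotProduct, sum_basis_zero, Finset.mul_sum]
  push_cast
  refine Finset.sum_congr rfl fun x _ => ?_
  simp [phaseState]
  ring

theorem groverStart_eq {n : ℕ} (I : Finset (Input n)) :
    groverStart I = phaseState (fun x => if x ∈ I then 1 / Real.sqrt (2 * I.card) else 0) := by
  ext z
  by_cases h : z.1 ∈ I
  · simp only [groverStart, phaseState, h, if_true]
    push_cast
    ring
  · simp [groverStart, phaseState, h]

theorem star_groverStart_dotProduct {n : ℕ} (I : Finset (Input n)) (h : Input n → ℝ) :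
    star (groverStart I) ⬝ᵥ phaseState h =
      ((2 * ((∑ x ∈ I, h x) / Real.sqrt (2 * I.card)) : ℝ) : ℂ) := by
  rw [groverStart_eq, star_phaseState_dotProduct, Finset.sum_div]
  congr 2
  simp only [ite_mul, zero_mul, Finset.sum_ite_mem, Finset.univ_inter]
  exact Finset.sum_congr rfl fun x _ => by ring

theorem star_groverStart_self {n : ℕ} {I : Finset (Input n)} (hI : I.Nonempty) :
    star (groverStart I) ⬝ᵥ groverStart I = 1 := by
  have hN : (0 : ℝ) < I.card := by exact_mod_cast hI.card_pos
  nth_rw 2 [groverStart_eq]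
  rw [star_groverStart_dotProduct, Finset.sum_congr rfl (g := fun _ => 1 / Real.sqrt (2 * I.card))
    (fun x hx => if_pos hx), Finset.sum_const, nsmul_eq_mul]
  have : Real.sqrt (2 * I.card) ^ 2 = 2 * I.card := Real.sq_sqrt (by positivity)
  have h1 : 2 * (I.card * (1 / Real.sqrt (2 * I.card)) / Real.sqrt (2 * I.card)) = 1 := by
    field_simp
    rw [this]
  rw [h1, Complex.ofReal_one]

theorem groverStep_mulVec {n : ℕ} {I : Finset (Input n)} (hI : I.Nonempty) (h : Input n → ℝ) :
    (-reflection (groverStart I)) *ᵥ phaseState h =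
      phaseState (fun x => (if x ∈ I then 2 * (∑ y ∈ I, h y) / I.card else 0) - h x) := by
  have hN : (0 : ℝ) < I.card := by exact_mod_cast hI.card_pos
  have hq : Real.sqrt (2 * I.card) ^ 2 = 2 * I.card := Real.sq_sqrt (by positivity)
  have hq0 : 0 < Real.sqrt (2 * I.card) := Real.sqrt_pos.mpr (by positivity)
  rw [Matrix.neg_mulVec, reflection_mulVec, star_groverStart_self hI,
    star_groverStart_dotProduct, groverStart_eq]
  ext z
  have key : -((if z.2.1 then -1 else 1) * h z.1 -
      2 / 1 * (2 * ((∑ x ∈ I, h x) / Real.sqrt (2 * I.card))) *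
        ((if z.2.1 then -1 else 1) * (if z.1 ∈ I then 1 / Real.sqrt (2 * I.card) else 0))) =
      (if z.2.1 then -1 else 1) *
        ((if z.1 ∈ I then 2 * (∑ y ∈ I, h y) / I.card else 0) - h z.1) := by
    by_cases hz : z.1 ∈ I
    · simp only [hz, if_true]
      have : 2 / 1 * (2 * ((∑ x ∈ I, h x) / Real.sqrt (2 * I.card))) *
          ((if z.2.1 then -1 else 1) * (1 / Real.sqrt (2 * I.card))) =
          (if z.2.1 then -1 else 1) * (4 * (∑ x ∈ I, h x)) / Real.sqrt (2 * I.card) ^ 2 := by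
        field_simp
        ring
      rw [this, hq]
      field_simp
      ring
    · simp only [hz, if_false]
      ring
  have key' := congrArg Complex.ofReal key
  simp only [Pi.neg_apply, Pi.sub_apply, Pi.smul_apply, smul_eq_mul, phaseState]
  rw [← key']
  push_cast
  ring

theorem QMQ_mulVec_phaseState {n : ℕ} (c : Concept n) (h : Input n → ℝ) :
    QMQ 0 c *ᵥ phaseState h = phaseState (fun x => if c x then -h x else h x) := by
  ext ⟨x, b, w⟩
  rw [QMQ_mulVec]
  cases b <;> cases hc : c x <;> simp [phaseState, hc]

theorem groverStart_mulVec {n : ℕ} {I : Finset (Input n)} (hI : I.Nonempty) :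
    reflection (startState n 0 - groverStart I) *ᵥ startState n 0 = groverStart I := by
  refine reflection_startState_sub _ ?_ ?_
  · have := star_groverStart_self hI
    rw [star_dotProduct_self] at this
    exact_mod_cast this
  · simp only [groverStart]
    split_ifs <;> simp

/-- The amplitude of the input `x` after `j` Grover iterations at angle `θ`. -/
def groverAmplitude {n : ℕ} (I : Finset (Input n)) (c : Concept n) (θ : ℝ) (j : ℕ)
    (x : Input n) : ℝ :=
  if x ∈ I then
    if c x then Real.sin ((2 * j + 1) * θ) / (Real.sin θ * Real.sqrt (2 * I.card))
    else Real.cos ((2 * j + 1) * θ) / (Real.cos θ * Real.sqrt (2 * I.card))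
  else 0

/-- The state stays in the plane spanned by the uniform target and non-target states, and each
iteration rotates it by 2θ. Any θ with the right sin² will do: dividing by sin θ and cos θ absorbs
their signs. The declared query number `k` plays no role in the state at time `j`. -/
theorem state_groverCircuit {n : ℕ} {I : Finset (Input n)} (c : Concept n) {θ : ℝ}
    (hT : 0 < (I.filter (fun x => c x = true)).card)
    (hs : Real.sin θ ^ 2 * I.card = (I.filter (fun x => c x = true)).card) (k j : ℕ) :
    (groverCircuit I k).state c j = phaseState (groverAmplitude I c θ j) := by
  have hI : I.Nonempty := by
    obtain ⟨x, hx⟩ := Finset.card_pos.mp hT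
    exact ⟨x, (Finset.mem_filter.mp hx).1⟩
  have hN : (0 : ℝ) < I.card := by exact_mod_cast hI.card_pos
  have hq : 0 < Real.sqrt (2 * I.card) := Real.sqrt_pos.mpr (by positivity)
  have hs0 : Real.sin θ ≠ 0 := by
    intro h
    rw [h] at hs
    have : (0 : ℝ) < (I.filter (fun x => c x = true)).card := by exact_mod_cast hT
    nlinarith
  have hcard : ((I.filter (fun x => c x = true)).card : ℝ) +
      (I.filter (fun x => ¬ c x = true)).card = I.card := by
    exact_mod_cast Finset.card_filter_add_card_filter_not (s := I) (fun x => c x = true)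
  have hcs := Real.sin_sq_add_cos_sq θ
  have hco : Real.cos θ ^ 2 * I.card = (I.filter (fun x => ¬ c x = true)).card := by
    linear_combination -hcard - hs + (I.card : ℝ) * hcs
  have hc0 : ∀ x ∈ I, c x = false → Real.cos θ ≠ 0 := by
    intro x hx hcx h
    rw [h] at hco
    have : 0 < (I.filter (fun x => ¬ c x = true)).card :=
      Finset.card_pos.mpr ⟨x, by simp [hx, hcx]⟩
    have : (0 : ℝ) < (I.filter (fun x => ¬ c x = true)).card := by exact_mod_cast this
    nlinarith
  induction j with
  | zero =>
    refine (groverStart_mulVec hI).trans ?_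
    rw [groverStart_eq]
    congr 1
    ext x
    unfold groverAmplitude
    by_cases hx : x ∈ I
    · cases hcx : c x with
      | false => have := hc0 x hx hcx; simp [hx]; field_simp
      | true => simp [hx]; field_simp
    · simp [hx]
  | succ j ih =>
    rw [QueryCircuit.state, ih]
    refine (congrArg (fun f => (-reflection (groverStart I)) *ᵥ f)
      (QMQ_mulVec_phaseState c _)).trans ?_
    rw [groverStep_mulVec hI]
    congr 1
    set φ : ℝ := (2 * j + 1) * θ with hφ
    have hφ' : (2 * ((j + 1 : ℕ) : ℝ) + 1) * θ = φ + 2 * θ := by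
      rw [hφ]; push_cast; ring
    -- There are sin²θ·|I| targets and cos²θ·|I| other inputs, so twice the mean after the sign
    -- change is a multiple of cos(φ + θ).
    have hmean : 2 * (∑ y ∈ I, if c y = true then -groverAmplitude I c θ j y
        else groverAmplitude I c θ j y) / I.card =
        2 / Real.sqrt (2 * I.card) *
          (Real.cos θ * Real.cos φ - Real.sin θ * Real.sin φ) := by
      rw [Finset.sum_ite, Finset.sum_congr rfl
        (g := fun _ => -(Real.sin φ / (Real.sin θ * Real.sqrt (2 * I.card)))) (fun x hx => by
          obtain ⟨h1, h2⟩ := Finset.mem_filter.mp hx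
          simp [groverAmplitude, h1, h2, hφ]),
        Finset.sum_congr (s₁ := I.filter (fun x => ¬ c x = true)) rfl
        (g := fun _ => Real.cos φ / (Real.cos θ * Real.sqrt (2 * I.card))) (fun x hx => by
          obtain ⟨h1, h2⟩ := Finset.mem_filter.mp hx
          simp [groverAmplitude, h1, h2, hφ]),
        Finset.sum_const, Finset.sum_const, nsmul_eq_mul, nsmul_eq_mul, ← hs, ← hco]
      -- If cos θ = 0 there are no non-targets in `I`; their term has factor cos²θ, and the division
      -- by zero has value 0.
      by_cases hc : Real.cos θ = 0
      · rw [hc]; field_simp; ring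
      · field_simp; ring
    rw [hmean]
    ext x
    unfold groverAmplitude
    rw [hφ', Real.sin_add, Real.cos_add, Real.sin_two_mul, Real.cos_two_mul]
    by_cases hx : x ∈ I
    · cases hcx : c x with
      | false =>
        have := hc0 x hx hcx
        simp only [hx, if_true, Bool.false_eq_true, if_false]
        field_simp
        ring
      | true =>
        simp only [hx, if_true]
        rw [← hφ]
        field_simp
        linear_combination (-2 * Real.sin φ) * hcs
    · simp [hx]

theorem groverCircuit_measure_target {n : ℕ} {I : Finset (Input n)} (c : Concept n) {θ : ℝ}
    (hT : 0 < (I.filter (fun x => c x = true)).card)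
    (hs : Real.sin θ ^ 2 * I.card = (I.filter (fun x => c x = true)).card) (j : ℕ) :
    ∑ z, (groverCircuit I j).measure c z * (if c z.1 then 1 else 0) =
      Real.sin ((2 * j + 1) * θ) ^ 2 := by
  have hT' : (0 : ℝ) < (I.filter (fun x => c x = true)).card := by exact_mod_cast hT
  have hN : (0 : ℝ) < I.card := by
    rcases (Nat.cast_nonneg I.card : (0 : ℝ) ≤ I.card).eq_or_lt with h | h
    · rw [← h, mul_zero] at hs; linarith
    · exact h
  have hs0 : Real.sin θ ≠ 0 := by
    intro h
    rw [h] at hs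
    nlinarith
  have hq : Real.sqrt (2 * I.card) ^ 2 = 2 * I.card := Real.sq_sqrt (by positivity)
  have hq0 : 0 < Real.sqrt (2 * I.card) := Real.sqrt_pos.mpr (by positivity)
  refine (sum_basis_zero (n := n) _).trans ?_
  have key : ∀ (x : Input n) (b : Bool),
      (groverCircuit I j).measure c (x, b, 0) = groverAmplitude I c θ j x ^ 2 := by
    intro x b
    unfold QueryCircuit.measure
    refine (congrArg (fun f => ‖f (x, b, 0)‖ ^ 2)
      (state_groverCircuit c hT hs j _)).trans ?_
    simp only [phaseState, Complex.norm_real, Real.norm_eq_abs, sq_abs]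
    cases b <;> simp [groverCircuit]
  have : ∀ x : Input n, (groverCircuit I j).measure c (x, true, 0) * (if c x then 1 else 0) +
      (groverCircuit I j).measure c (x, false, 0) * (if c x then 1 else 0) =
      if x ∈ I.filter (fun x => c x = true) then
        2 * (Real.sin ((2 * j + 1) * θ) / (Real.sin θ * Real.sqrt (2 * I.card))) ^ 2 else 0 := by
    intro x
    rw [key, key]
    by_cases hx : x ∈ I <;> by_cases hcx : c x = true <;>
      simp [groverAmplitude, hx, hcx]
    ring
  refine (Finset.sum_congr rfl fun x _ => this x).trans ?_
  rw [Finset.sum_ite_mem, Finset.univ_inter, Finset.sum_const, nsmul_eq_mul, ← hs, div_pow,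
    mul_pow, hq]
  field_simp

/-! ### The success probability of Grover search -/

/-- A telescoping sum: 2 sin(2θ) cos((4j+2)θ) = sin(4(j+1)θ) - sin(4jθ). -/
theorem four_mul_sin_mul_sum (θ : ℝ) (m : ℕ) :
    4 * Real.sin (2 * θ) * ∑ j ∈ Finset.range m, Real.sin ((2 * j + 1) * θ) ^ 2 =
      2 * m * Real.sin (2 * θ) - Real.sin (4 * m * θ) := by
  induction m with
  | zero => simp
  | succ m ih =>
    have h1 : Real.sin (4 * ((m + 1 : ℕ) : ℝ) * θ) - Real.sin (4 * m * θ) =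
        2 * Real.sin (2 * θ) * Real.cos (2 * ((2 * m + 1) * θ)) := by
      rw [Real.sin_sub_sin]
      push_cast
      ring_nf
    rw [Real.cos_two_mul, Real.cos_sq'] at h1
    rw [Finset.sum_range_succ, mul_add, ih]
    push_cast at h1 ⊢
    linear_combination h1

theorem quarter_le_sum_sin_sq {θ : ℝ} {m : ℕ} (h0 : 0 ≤ Real.sin (2 * θ))
    (h : 1 ≤ m * Real.sin (2 * θ)) :
    (m : ℝ) / 4 ≤ ∑ j ∈ Finset.range m, Real.sin ((2 * j + 1) * θ) ^ 2 := by
  have h1 := four_mul_sin_mul_sum θ m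
  have h2 := Real.sin_le_one (4 * m * θ)
  have hpos : 0 < Real.sin (2 * θ) := by
    rcases h0.eq_or_lt with h' | h'
    · rw [← h'] at h; norm_num at h
    · exact h'
  refine le_of_mul_le_mul_left ?_ (mul_pos (by norm_num : (0 : ℝ) < 4) hpos)
  rw [h1]
  linarith

theorem sum_sin_sq_ge {N T m : ℕ} (hT : 0 < T) (hTN : T ≤ N) (hm : Real.sqrt N ≤ m) :
    ∃ θ : ℝ, Real.sin θ ^ 2 * N = T ∧
      (m : ℝ) / 4 ≤ ∑ j ∈ Finset.range m, Real.sin ((2 * j + 1) * θ) ^ 2 := by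
  have hN : (0 : ℝ) < N := by exact_mod_cast hT.trans_le hTN
  have hT1 : (1 : ℝ) ≤ T := by exact_mod_cast hT
  -- When everything is a target, sin 2θ = 0 and `quarter_le_sum_sin_sq` does not apply; but all odd
  -- multiples of π/2 have sine ±1.
  rcases hTN.eq_or_lt with rfl | hlt
  · refine ⟨Real.pi / 2, by simp, ?_⟩
    have : ∀ j ∈ Finset.range m, Real.sin ((2 * j + 1) * (Real.pi / 2)) ^ 2 = 1 := by
      intro j _
      have h : (2 * (j : ℝ) + 1) * (Real.pi / 2) = j * Real.pi + Real.pi / 2 := by ring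
      rw [h, Real.sin_add_pi_div_two, Real.cos_sq', Real.sin_nat_mul_pi]
      norm_num
    rw [Finset.sum_congr rfl this]
    simp only [Finset.sum_const, Finset.card_range, nsmul_eq_mul, mul_one]
    linarith [(Nat.cast_nonneg m : (0 : ℝ) ≤ m)]
  · have hlt' : (T : ℝ) + 1 ≤ N := by exact_mod_cast hlt
    have hr0 : (0 : ℝ) ≤ T / N := by positivity
    have hr1 : (T : ℝ) / N ≤ 1 := by rw [div_le_one hN]; linarith
    have hsin : Real.sin (Real.arcsin (Real.sqrt (T / N))) = Real.sqrt (T / N) :=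
      Real.sin_arcsin (by linarith [Real.sqrt_nonneg ((T : ℝ) / N)]) (Real.sqrt_le_one.mpr hr1)
    have hcos : Real.cos (Real.arcsin (Real.sqrt (T / N))) = Real.sqrt (1 - T / N) := by
      rw [Real.cos_arcsin, Real.sq_sqrt hr0]
    have h2 : Real.sin (2 * Real.arcsin (Real.sqrt (T / N))) =
        2 * Real.sqrt (T / N) * Real.sqrt (1 - T / N) := by
      rw [Real.sin_two_mul, hsin, hcos]
    refine ⟨Real.arcsin (Real.sqrt (T / N)), ?_, quarter_le_sum_sin_sq ?_ ?_⟩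
    · rw [hsin, Real.sq_sqrt hr0]
      field_simp
    · rw [h2]; positivity
    · rw [h2]
      have hm2 : (N : ℝ) ≤ (m : ℝ) ^ 2 := by
        rw [← Real.sq_sqrt hN.le]
        gcongr
      refine (one_le_sq_iff₀ (by positivity)).mp ?_
      rw [mul_pow, mul_pow, mul_pow, Real.sq_sqrt hr0, Real.sq_sqrt (by linarith)]
      -- This is 4T(N - T)/N ≥ 1, which follows from 1 ≤ T ≤ N - 1.
      calc (1 : ℝ) ≤ N * (2 ^ 2 * (T / N) * (1 - T / N)) := by
            have : (N : ℝ) * (2 ^ 2 * (T / N) * (1 - T / N)) = 4 * T * (N - T) / N := by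
              field_simp
              ring
            rw [this, le_div_iff₀ hN]
            nlinarith
        _ ≤ (m : ℝ) ^ 2 * (2 ^ 2 * (T / N) * (1 - T / N)) := by
            gcongr

theorem expect_groverRound_miss_le {n : ℕ} {I : Finset (Input n)} {c : Concept n}
    (h : ∃ x ∈ I, c x = true) :
    (groverRound I).expect c (fun a => if c a then 0 else 1) ≤ 3 / 4 := by
  have hT : 0 < (I.filter (fun x => c x = true)).card := by
    obtain ⟨x, hx, hc⟩ := h
    exact Finset.card_pos.mpr ⟨x, by simp [hx, hc]⟩
  -- `rand M` chooses among `M + 1` options; truncated subtraction still leaves `M + 1` at least the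
  -- ceiling.
  set M := ⌈Real.sqrt I.card⌉₊ - 1 with hM
  have hm : Real.sqrt I.card ≤ ((M + 1 : ℕ) : ℝ) :=
    (Nat.le_ceil _).trans (by exact_mod_cast (by omega))
  obtain ⟨θ, hs, hsum⟩ := sum_sin_sq_ge hT (Finset.card_filter_le _ _) hm
  have key : (groverRound I).expect c (fun a => if c a then 1 else 0) =
      (∑ j ∈ Finset.range (M + 1), Real.sin ((2 * j + 1) * θ) ^ 2) / (M + 1) := by
    rw [Finset.sum_range]
    refine congrArg (· / ((M : ℝ) + 1)) (Finset.sum_congr rfl fun j _ => ?_)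
    exact groverCircuit_measure_target c hT hs j
  have h1 : (groverRound I).expect c (fun a => if c a then 0 else 1) =
      1 - (groverRound I).expect c (fun a => if c a then 1 else 0) := by
    rw [← Procedure.expect_one_sub]
    congr 1
    ext a
    split_ifs <;> norm_num
  rw [h1, key]
  have hpos : (0 : ℝ) < M + 1 := by positivity
  have : (1 : ℝ) / 4 ≤
      (∑ j ∈ Finset.range (M + 1), Real.sin ((2 * j + 1) * θ) ^ 2) / (M + 1) := by
    rw [le_div_iff₀ hpos]
    push_cast at hsum
    linarith
  linarith

/-- A hit ends the search, so a miss requires all `r + 1` rounds, run on fresh registers, to miss.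
-/
theorem expect_groverRounds_miss_le {n : ℕ} {I : Finset (Input n)} {c : Concept n}
    (h : ∃ x ∈ I, c x = true) (r : ℕ) :
    (groverRounds I r).expect c (fun a => if c a then 0 else 1) ≤ (3 / 4) ^ (r + 1) := by
  induction r with
  | zero => simpa [groverRounds] using expect_groverRound_miss_le h
  | succ r ih =>
    rw [groverRounds, Procedure.expect_bind, pow_succ']
    calc _ ≤ (groverRound I).expect c
          (fun a => (if c a then 0 else 1) * (3 / 4 : ℝ) ^ (r + 1)) := by
          refine Procedure.expect_mono _ _ fun a => ?_
          cases hc : c a with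
          | true => simp [Procedure.expect, hc]
          | false => simpa [Procedure.expect, hc] using ih
      _ ≤ _ := by
          rw [Procedure.expect_mul_const]
          gcongr
          exact expect_groverRound_miss_le h

/-- The result of the inner loop for the target `c`: `0` if it is correct, and `1` if not. -/
def innerError {n : ℕ} (I : Finset (Input n)) (c : Concept n) : Option (Input n) → ℝ
  | some a => if c a then 0 else 1
  | none => if ∀ x ∈ I, c x = false then 0 else 1

/-- The only possible error is `none` in spite of a target, since a result `some a` has been
checked. Without targets every check fails, and `none` is certain and correct. -/
theorem expect_innerLoop_error_le {n : ℕ} (I : Finset (Input n)) (c : Concept n) (r : ℕ) :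
    (innerLoop I r).expect c (innerError I c) ≤ (1 / 2) ^ r := by
  induction r with
  | zero =>
    simp only [innerLoop, Procedure.expect, innerError, pow_zero]
    split_ifs <;> norm_num
  | succ r ih =>
    rw [innerLoop, Procedure.expect_bind, pow_succ']
    by_cases h : ∃ x ∈ I, c x = true
    · calc _ ≤ (groverSearch I).expect c
            (fun a => (if c a then 0 else 1) * (1 / 2 : ℝ) ^ r) := by
            refine Procedure.expect_mono _ _ fun a => ?_
            cases hc : c a with
            | true => simp [Procedure.expect, hc, innerError]
            | false => simpa [Procedure.expect, hc] using ih
        _ ≤ _ := by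
            rw [Procedure.expect_mul_const]
            gcongr
            -- Four rounds: (3/4)^4 = 81/256 ≤ 1/2.
            exact (expect_groverRounds_miss_le h 3).trans (by norm_num)
    · have h0 : ∀ r, (innerLoop I r).expect c (innerError I c) ≤ 0 := by
        intro r
        induction r with
        | zero =>
          have : ∀ x ∈ I, c x = false := by
            intro x hx
            by_contra hc
            exact h ⟨x, hx, by simpa using hc⟩
          simp only [innerLoop, Procedure.expect, innerError]
          rw [if_pos this]
        | succ r ih' =>
          rw [innerLoop, Procedure.expect_bind]
          refine le_trans (Procedure.expect_mono _ _ (h := fun _ => 0) fun a => ?_)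
            (Procedure.expect_const _ _ 0).le
          cases hc : c a with
          | true => simp [Procedure.expect, hc, innerError]
          | false => simpa [Procedure.expect, hc] using ih'
      refine le_trans ?_ (by positivity : (0 : ℝ) ≤ 1 / 2 * (1 / 2) ^ r)
      rw [← Procedure.expect_bind]
      exact h0 (r + 1)

/-! ### Column flips and balanced inputs -/

theorem flipConcept_flipConcept {n : ℕ} (K : Finset (Input n)) (c : Concept n) :
    flipConcept K (flipConcept K c) = c := by
  ext x; simp [flipConcept]

theorem flipConcept_injective {n : ℕ} (K : Finset (Input n)) :
    Function.Injective (flipConcept K) :=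
  (show Function.Involutive (flipConcept K) from flipConcept_flipConcept K).injective

theorem columnFlip_columnFlip {n : ℕ} (K : Finset (Input n)) (S : Finset (Concept n)) :
    columnFlip K (columnFlip K S) = S := by
  unfold columnFlip
  rw [Finset.image_image, (show Function.Involutive (flipConcept K) from
    flipConcept_flipConcept K).comp_self, Finset.image_id]

theorem card_columnFlip {n : ℕ} (K : Finset (Input n)) (S : Finset (Concept n)) :
    (columnFlip K S).card = S.card :=
  Finset.card_image_of_injective _ (flipConcept_injective K)

theorem countAt_columnFlip {n : ℕ} (K : Finset (Input n)) (S : Finset (Concept n))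
    (a : Input n) (b : Bool) :
    countAt (columnFlip K S) a b = countAt S a (xor b (indicator K a)) := by
  unfold countAt columnFlip
  rw [Finset.filter_image, Finset.card_image_of_injective _ (flipConcept_injective K)]
  congr 1
  refine Finset.filter_congr fun c _ => ?_
  unfold flipConcept
  cases c a <;> cases b <;> cases indicator K a <;> simp

theorem countAt_add {n : ℕ} (S : Finset (Concept n)) (a : Input n) :
    countAt S a false + countAt S a true = S.card := by
  have := Finset.card_filter_add_card_filter_not (s := S) (fun c => c a = false)
  simpa [countAt] using this

/-- After the flip the ones are the minority in every column. This gives both the halving after an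
answer 1 and the progress of the greedy choice, whose score is thus a lower bound for the unflipped
count of ones. -/
theorem countAt_flip_true {n : ℕ} (S : Finset (Concept n)) (a : Input n) :
    countAt (columnFlip (flipSet S) S) a true = min (countAt S a false) (countAt S a true) := by
  rw [countAt_columnFlip]
  by_cases h : countAt S a false < countAt S a true
  · have : indicator (flipSet S) a = true := by simp [indicator, flipSet, h]
    rw [this, min_eq_left h.le]
    rfl
  · have : indicator (flipSet S) a = false := by simp [indicator, flipSet, h]
    rw [this, min_eq_right (not_lt.mp h)]
    rfl

/-- Each set of at least two concepts of `C` is split by some input into two parts, neither of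
which is smaller than the fraction `γ`. -/
def SplitBound {n : ℕ} (γ : ℝ) (C : Finset (Concept n)) : Prop :=
  ∀ D ⊆ C, 2 ≤ D.card →
    ∃ a, γ * D.card ≤ countAt D a false ∧ γ * D.card ≤ countAt D a true

theorem SplitBound.mono {n : ℕ} {γ : ℝ} {C D : Finset (Concept n)} (h : SplitBound γ C)
    (hD : D ⊆ C) : SplitBound γ D :=
  fun E hE => h E (hE.trans hD)

theorem SplitBound.columnFlip {n : ℕ} {γ : ℝ} {C : Finset (Concept n)} (h : SplitBound γ C)
    (K : Finset (Input n)) : SplitBound γ (columnFlip K C) := by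
  intro D hD hcard
  have hD' : QuantumLearning.columnFlip K D ⊆ C := by
    rw [← columnFlip_columnFlip K C]
    exact Finset.image_subset_image hD
  obtain ⟨a, h1, h2⟩ := h _ hD' (by rwa [card_columnFlip])
  rw [card_columnFlip, countAt_columnFlip] at h1 h2
  refine ⟨a, ?_⟩
  cases hK : indicator K a <;> rw [hK] at h1 h2
  · exact ⟨h1, h2⟩
  · exact ⟨h2, h1⟩

/-- Two distinct concepts differ at some input, where both values then occur. This makes `gammaHat`
positive and settles |C| = 2. -/
theorem one_div_card_le_gamma {n : ℕ} {D : Finset (Concept n)} (hD : 2 ≤ D.card) :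
    1 / (D.card : ℝ) ≤ gamma D := by
  obtain ⟨c, hc, c', hc', hne⟩ := Finset.one_lt_card.mp hD
  obtain ⟨a, ha⟩ := Function.ne_iff.mp hne
  refine le_trans ?_ (le_ciSup (Set.finite_range (gammaAt D)).bddAbove a)
  have hpos : ∀ b, (1 : ℝ) ≤ countAt D a b := by
    intro b
    have : 0 < countAt D a b := by
      by_cases h : c a = b
      · exact Finset.card_pos.mpr ⟨c, by simp [hc, h]⟩
      · refine Finset.card_pos.mpr ⟨c', ?_⟩
        rw [Finset.mem_filter]
        refine ⟨hc', ?_⟩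
        cases hca : c a <;> cases hca' : c' a <;> cases b <;> simp_all
    exact_mod_cast this
  unfold gammaAt
  refine le_min ?_ ?_ <;> gcongr <;> exact hpos _

theorem splitBound_gammaHat {n : ℕ} (C : Finset (Concept n)) : SplitBound (gammaHat C) C := by
  intro D hD hcard
  obtain ⟨a, ha⟩ := exists_eq_ciSup_of_finite (f := gammaAt D)
  have h1 : gammaHat C ≤ gammaAt D a := by
    rw [ha]
    exact ciInf_le (Set.finite_range _).bddBelow
      (⟨D, hD, hcard⟩ : {C' : Finset (Concept n) // C' ⊆ C ∧ 2 ≤ C'.card})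
  have hpos : (0 : ℝ) < D.card := by exact_mod_cast (by omega : 0 < D.card)
  refine ⟨a, ?_, ?_⟩ <;> rw [← le_div_iff₀ hpos]
  · exact h1.trans (min_le_left _ _)
  · exact h1.trans (min_le_right _ _)

theorem one_div_card_le_gammaHat {n : ℕ} {C : Finset (Concept n)} (hC : 2 ≤ C.card) :
    1 / (C.card : ℝ) ≤ gammaHat C := by
  have : Nonempty {C' : Finset (Concept n) // C' ⊆ C ∧ 2 ≤ C'.card} :=
    ⟨⟨C, Finset.Subset.refl C, hC⟩⟩
  refine le_ciInf fun D => le_trans ?_ (one_div_card_le_gamma D.2.2)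
  have : (0 : ℝ) < D.1.card := by exact_mod_cast (by have := D.2.2; omega : 0 < D.1.card)
  gcongr
  exact D.2.1

theorem gammaHat_pos {n : ℕ} {C : Finset (Concept n)} (hC : 2 ≤ C.card) : 0 < gammaHat C := by
  refine lt_of_lt_of_le ?_ (one_div_card_le_gammaHat hC)
  have : (0 : ℝ) < C.card := by exact_mod_cast (by omega : 0 < C.card)
  positivity

theorem SplitBound.le_one {n : ℕ} {γ : ℝ} {C : Finset (Concept n)} (h : SplitBound γ C)
    (hC : 2 ≤ C.card) : γ ≤ 1 := by
  obtain ⟨a, h1, _⟩ := h C (Finset.Subset.refl C) hC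
  have hpos : (0 : ℝ) < C.card := by exact_mod_cast (by omega : 0 < C.card)
  have : (countAt C a false : ℝ) ≤ C.card := by exact_mod_cast Finset.card_filter_le _ _
  nlinarith

/-! ### The greedy construction -/

/-- The concepts of `C` that yield `1` at some input of `I`. -/
def covered {n : ℕ} (C : Finset (Concept n)) (I : Finset (Input n)) : Finset (Concept n) :=
  C.filter (fun c => ∃ x ∈ I, c x = true)

theorem covered_insert {n : ℕ} (C : Finset (Concept n)) (I : Finset (Input n)) (a : Input n) :
    covered C (insert a I) = covered C I ∪ C.filter (fun c => c a = true) := by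
  ext c
  simp only [covered, Finset.mem_filter, Finset.mem_union, Finset.exists_mem_insert]
  rw [← and_or_left, or_comm]

/-- An input that splits the uncovered concepts well lies outside `I`, and so the greedy choice
covers at least as many new concepts. -/
theorem exists_balanced_notMem {n : ℕ} {γ : ℝ} (hγ : 0 < γ) {C : Finset (Concept n)}
    (h : SplitBound γ C) {I : Finset (Input n)} (hcard : 2 ≤ (C \ covered C I).card) :
    ∃ a ∉ I, γ * (C \ covered C I).card ≤
      countAt (columnFlip (flipSet (C \ covered C I)) (C \ covered C I)) a true := by
  obtain ⟨a, h1, h2⟩ := h _ Finset.sdiff_subset hcard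
  have hpos : (0 : ℝ) < (C \ covered C I).card := by
    exact_mod_cast (by omega : 0 < (C \ covered C I).card)
  refine ⟨a, fun ha => ?_, ?_⟩
  · have h0 : countAt (C \ covered C I) a true = 0 := by
      refine Finset.card_eq_zero.mpr (Finset.filter_eq_empty_iff.mpr fun c hc hca => ?_)
      obtain ⟨hcC, hcI⟩ := Finset.mem_sdiff.mp hc
      exact hcI (Finset.mem_filter.mpr ⟨hcC, a, ha, hca⟩)
    rw [h0] at h2
    have := mul_pos hγ hpos
    norm_num at h2
    linarith
  · rw [countAt_flip_true]
    push_cast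
    exact le_min h1 h2

theorem card_union_filter_ge {n : ℕ} (C S : Finset (Concept n)) (a : Input n) :
    S.card + countAt (C \ S) a true ≤ (S ∪ C.filter (fun c => c a = true)).card := by
  unfold countAt
  rw [← Finset.card_union_of_disjoint]
  · refine Finset.card_le_card (Finset.union_subset_union_right ?_)
    exact Finset.filter_subset_filter _ Finset.sdiff_subset
  · exact Finset.disjoint_sdiff.mono_right (Finset.filter_subset _ _)

/-- The invariant `hI` says that every input chosen so far has covered at least γ|C|/2 new concepts
on average. Together with `hS` it gives |I|γ < 1 before each round, and the final round adds one
more input, whence the `- 1`. The hypothesis `hk` says that the fuel suffices. -/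
theorem greedyLoop_spec {n : ℕ} {γ : ℝ} (hγ : 0 < γ) {C : Finset (Concept n)}
    (hC : 2 ≤ C.card) (h : SplitBound γ C) (k : ℕ) (I : Finset (Input n))
    (hk : Fintype.card (Input n) ≤ k + I.card) (hS : 2 * (covered C I).card < C.card)
    (hI : I.card * (γ * C.card) ≤ 2 * (covered C I).card) :
    C.card ≤ 2 * (covered C (greedyLoop C k (covered C I) I)).card ∧
      ((greedyLoop C k (covered C I) I).card - 1) * γ ≤ 1 := by
  induction k generalizing I with
  | zero =>
    have hD := Finset.card_sdiff_add_card_eq_card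
      (show covered C I ⊆ C from Finset.filter_subset _ _)
    -- Fuel 0 would force `I` to contain all inputs, but a splitting input lies outside `I`.
    obtain ⟨a, ha, _⟩ := exists_balanced_notMem hγ h (I := I) (by omega)
    exact absurd ((Finset.card_eq_iff_eq_univ I).mp
      (le_antisymm (Finset.card_le_univ I) (by omega)) ▸ Finset.mem_univ a) ha
  | succ k ih =>
    have hD := Finset.card_sdiff_add_card_eq_card
      (show covered C I ⊆ C from Finset.filter_subset _ _)
    obtain ⟨a₀, ha₀, hbal⟩ := exists_balanced_notMem hγ h (I := I) (by omega)
    have hX : (Finset.univ \ I).Nonempty := ⟨a₀, by simp [ha₀]⟩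
    unfold greedyLoop
    simp only [dif_pos hX]
    set f := fun x => countAt (columnFlip (flipSet (C \ covered C I)) (C \ covered C I)) x true
    have hspec := ((Finset.univ \ I).exists_max_image f hX).choose_spec
    change argmaxOn (Finset.univ \ I) hX f ∈ Finset.univ \ I ∧
      ∀ x' ∈ Finset.univ \ I, f x' ≤ f (argmaxOn (Finset.univ \ I) hX f) at hspec
    set a := argmaxOn (Finset.univ \ I) hX f
    have haI : a ∉ I := (Finset.mem_sdiff.mp hspec.1).2
    have hmax : f a₀ ≤ f a := hspec.2 a₀ (by simp [ha₀])
    have hfa : f a ≤ countAt (C \ covered C I) a true :=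
      (countAt_flip_true _ _).le.trans (min_le_right _ _)
    have hnew := card_union_filter_ge C (covered C I) a
    rw [← covered_insert] at hnew ⊢
    have hcardI : ((insert a I).card : ℝ) = I.card + 1 := by
      rw [Finset.card_insert_of_notMem haI]; push_cast; ring
    have hCpos : (0 : ℝ) < C.card := by exact_mod_cast (by omega : 0 < C.card)
    have hSr : 2 * ((covered C I).card : ℝ) < C.card := by exact_mod_cast hS
    have hDr : ((C \ covered C I).card : ℝ) + (covered C I).card = C.card := by
      exact_mod_cast hD
    split_ifs with hcover
    · refine ⟨hcover, ?_⟩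
      rw [hcardI, add_sub_cancel_right]
      refine le_of_mul_le_mul_right ?_ hCpos
      linarith
    · refine ih (insert a I) ?_ (not_le.mp hcover) ?_
      · rw [Finset.card_insert_of_notMem haI]; omega
      -- More than half of `C` is still uncovered, so the gain of at least γ times the uncovered
      -- part is at least γ|C|/2.
      · have h1 : ((covered C I).card : ℝ) + γ * (C \ covered C I).card ≤
            (covered C (insert a I)).card := by
          have h2 : (f a₀ : ℝ) ≤ countAt (C \ covered C I) a true := by
            exact_mod_cast hmax.trans hfa
          have h3 : ((covered C I).card : ℝ) + countAt (C \ covered C I) a true ≤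
            (covered C (insert a I)).card := by exact_mod_cast hnew
          linarith
        rw [hcardI]
        nlinarith

theorem greedyInputs_spec {n : ℕ} {γ : ℝ} (hγ : 0 < γ) {C : Finset (Concept n)}
    (hC : 2 ≤ C.card) (h : SplitBound γ C) :
    C.card ≤ 2 * (covered C (greedyInputs C)).card ∧ ((greedyInputs C).card - 1) * γ ≤ 1 := by
  have h0 : covered C (∅ : Finset (Input n)) = ∅ := by simp [covered]
  have := greedyLoop_spec hγ hC h (Fintype.card (Input n)) ∅ (by simp)
    (by rw [h0, Finset.card_empty]; omega) (by simp)
  rwa [h0] at this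

/-! ### The number of queries -/

theorem queries_groverRound_le {n : ℕ} (I : Finset (Input n)) :
    (groverRound I).queries ≤ ⌈Real.sqrt I.card⌉₊ - 1 := by
  unfold groverRound
  simp only [Procedure.queries]
  refine Finset.sup_le fun j _ => ?_
  have : (groverCircuit I j).queries = j := rfl
  rw [this]
  refine (Nat.add_le_add_left (Finset.sup_le fun z _ => le_rfl) _).trans ?_
  have := j.2
  omega

theorem queries_query_ite_le {n : ℕ} {α : Type} (x : Input n) (P Q : Procedure n α) :
    (Procedure.query x (fun b => if b then P else Q)).queries ≤
      1 + max P.queries Q.queries := by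
  simp only [Procedure.queries]
  gcongr
  refine Finset.sup_le fun b _ => ?_
  cases b <;> simp

theorem queries_groverRounds_le {n : ℕ} (I : Finset (Input n)) (r : ℕ) :
    (groverRounds I r).queries ≤
      r * (⌈Real.sqrt I.card⌉₊ - 1 + 1) + (⌈Real.sqrt I.card⌉₊ - 1) := by
  induction r with
  | zero => simpa [groverRounds] using queries_groverRound_le I
  | succ r ih =>
    refine (Procedure.queries_bind_le _ _ fun a =>
      (queries_query_ite_le a _ _).trans (Nat.add_le_add_left (max_le (Nat.zero_le _) ih) 1)).trans
        ?_
    have := queries_groverRound_le I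
    rw [add_mul]
    omega

/-- With m = max(⌈√|I|⌉, 1), a search takes at most 3m + (m - 1) queries, and the classical check
raises this to 4m. -/
theorem queries_innerLoop_le {n : ℕ} (I : Finset (Input n)) (r : ℕ) :
    (innerLoop I r).queries ≤ r * (4 * (⌈Real.sqrt I.card⌉₊ - 1 + 1)) := by
  induction r with
  | zero => simp [innerLoop, Procedure.queries]
  | succ r ih =>
    refine (Procedure.queries_bind_le _ _ fun a =>
      (queries_query_ite_le a _ _).trans (Nat.add_le_add_left (max_le (Nat.zero_le _) ih) 1)).trans
        ?_
    have h3 := queries_groverRounds_le I 3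
    change (groverSearch I).queries ≤ _ at h3
    rw [add_mul]
    omega

/-- The next set of candidates, given the result of the inner loop. -/
def nextCandidates {n : ℕ} (S : Finset (Concept n)) : Option (Input n) → Finset (Concept n)
  | some a => columnFlip (flipSet S)
      ((columnFlip (flipSet S) S).filter (fun c => c a = true))
  | none => columnFlip (flipSet S) ((columnFlip (flipSet S) S).filter
      (fun c => ∀ x ∈ greedyInputs (columnFlip (flipSet S) S), c x = false))

theorem nextCandidates_subset {n : ℕ} (S : Finset (Concept n)) (res : Option (Input n)) :
    nextCandidates S res ⊆ S := by
  cases res <;>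
  · nth_rw 2 [← columnFlip_columnFlip (flipSet S) S]
    exact Finset.image_subset_image (Finset.filter_subset _ _)

/-- For `some a` the survivors form a minority column; for `none` they are the concepts left
uncovered by the greedy set. The target does not enter, so the worst-case count holds on every
oracle. -/
theorem card_nextCandidates_le {n : ℕ} {γ : ℝ} (hγ : 0 < γ) {S : Finset (Concept n)}
    (hS : 2 ≤ S.card) (h : SplitBound γ S) (res : Option (Input n)) :
    2 * (nextCandidates S res).card ≤ S.card := by
  cases res with
  | some a =>
    simp only [nextCandidates, card_columnFlip]
    have h1 := countAt_flip_true S a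
    have h2 := countAt_add S a
    unfold countAt at h1 h2
    omega
  | none =>
    simp only [nextCandidates, card_columnFlip]
    have h1 := (greedyInputs_spec hγ (by rwa [card_columnFlip]) (h.columnFlip (flipSet S))).1
    have h2 := Finset.card_filter_add_card_filter_not (s := columnFlip (flipSet S) S)
      (fun c => ∃ x ∈ greedyInputs (columnFlip (flipSet S) S), c x = true)
    unfold covered at h1
    rw [card_columnFlip] at h1 h2
    simp only [not_exists, not_and, Bool.not_eq_true] at h2
    omega

theorem outerLoop_succ {n : ℕ} (r k : ℕ) {S : Finset (Concept n)} (hS : 2 ≤ S.card) :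
    outerLoop r (k + 1) S =
      ((innerLoop (greedyInputs (columnFlip (flipSet S) S)) r).simulate (flipSet S)).bind
        (fun res => outerLoop r k (nextCandidates S res)) := by
  rw [outerLoop, if_neg (by omega)]
  refine congrArg (Procedure.bind _) (funext fun res => ?_)
  cases res <;> rfl

/-- By halving, `t` bounds the number of rounds that actually query, whatever the fuel `k`. -/
theorem queries_outerLoop_le {n : ℕ} {γ : ℝ} (hγ : 0 < γ) {S : Finset (Concept n)}
    (h : SplitBound γ S) (r k t B : ℕ) (ht : S.card < 2 ^ (t + 1))
    (hB : ∀ D ⊆ S, 2 ≤ D.card →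
      (innerLoop (greedyInputs (columnFlip (flipSet D) D)) r).queries ≤ B) :
    (outerLoop r k S).queries ≤ t * B := by
  induction k generalizing S t with
  | zero => simp [outerLoop, Procedure.queries]
  | succ k ih =>
    by_cases hS : S.card ≤ 1
    · rw [outerLoop, if_pos hS]
      simp [Procedure.queries]
    · have hS2 : 2 ≤ S.card := by omega
      cases t with
      | zero => omega
      | succ t =>
        rw [outerLoop_succ r k hS2, add_mul, one_mul, add_comm]
        refine (Procedure.queries_bind_le _ _ (q := t * B) fun res => ?_).trans ?_
        · refine ih (h.mono (nextCandidates_subset S res)) t ?_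
            fun D hD => hB D (hD.trans (nextCandidates_subset S res))
          have := card_nextCandidates_le hγ hS2 h res
          rw [pow_succ] at ht
          omega
        · rw [Procedure.queries_simulate]
          have := hB S (Finset.Subset.refl S) hS2
          omega

theorem queries_innerLoop_greedy_le {n : ℕ} {γ : ℝ} (hγ : 0 < γ) {S : Finset (Concept n)}
    (hS : 2 ≤ S.card) (h : SplitBound γ S) (r : ℕ) :
    (innerLoop (greedyInputs (columnFlip (flipSet S) S)) r).queries ≤
      r * (4 * (⌊2 / Real.sqrt γ⌋₊ + 1)) := by
  refine (queries_innerLoop_le _ r).trans ?_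
  gcongr
  have h1 := (greedyInputs_spec hγ (by rwa [card_columnFlip]) (h.columnFlip (flipSet S))).2
  have hγ1 := h.le_one hS
  set N := (greedyInputs (columnFlip (flipSet S) S)).card
  have hsq : Real.sqrt N ≤ 2 / Real.sqrt γ := by
    rw [le_div_iff₀ (Real.sqrt_pos.mpr hγ), ← Real.sqrt_mul (Nat.cast_nonneg N)]
    -- From (N - 1)γ ≤ 1 and γ ≤ 1 one gets Nγ ≤ 2, which is below 2².
    refine Real.sqrt_le_iff.mpr ⟨by norm_num, ?_⟩
    linarith
  refine Nat.le_floor ?_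
  rcases Nat.eq_zero_or_pos ⌈Real.sqrt N⌉₊ with h0 | h0
  · rw [h0]; simp; positivity
  · rw [Nat.cast_pred h0]
    have := Nat.ceil_lt_add_one (Real.sqrt_nonneg (N : ℝ))
    linarith

theorem queries_learningAlgorithm_le {n : ℕ} {C : Finset (Concept n)} (hC : 2 ≤ C.card) :
    ((learningAlgorithm C).queries : ℝ) ≤
      12 * (Real.logb 2 C.card * ⌈Real.logb 2 (3 * Real.logb 2 C.card)⌉₊ /
        Real.sqrt (gammaHat C)) := by
  have hγ := gammaHat_pos hC
  have h := splitBound_gammaHat C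
  have hq : 0 < Real.sqrt (gammaHat C) := Real.sqrt_pos.mpr hγ
  set r := ⌈Real.logb 2 (3 * Real.logb 2 C.card)⌉₊
  have h1 := queries_outerLoop_le hγ h r C.card (Nat.log 2 C.card)
    (r * (4 * (⌊2 / Real.sqrt (gammaHat C)⌋₊ + 1)))
    (Nat.lt_pow_succ_log_self (by norm_num) _)
    (fun D hD hD2 => queries_innerLoop_greedy_le hγ hD2 (h.mono hD) r)
  have h2 : ((learningAlgorithm C).queries : ℝ) ≤
      Nat.log 2 C.card * (r * (4 * (⌊2 / Real.sqrt (gammaHat C)⌋₊ + 1))) := by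
    exact_mod_cast h1
  refine h2.trans ?_
  have h3 : (Nat.log 2 C.card : ℝ) ≤ Real.logb 2 C.card := by
    exact_mod_cast Real.natLog_le_logb C.card 2
  -- Since γ ≤ 1, the additive 1 is absorbed into 1/√γ; the constant 12 is 4 · 3.
  have h4 : (⌊2 / Real.sqrt (gammaHat C)⌋₊ : ℝ) + 1 ≤ 3 / Real.sqrt (gammaHat C) := by
    have h5 := Nat.floor_le (show (0 : ℝ) ≤ 2 / Real.sqrt (gammaHat C) by positivity)
    have h6 : 1 ≤ 1 / Real.sqrt (gammaHat C) := by
      rw [le_div_iff₀ hq, one_mul]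
      exact Real.sqrt_le_one.mpr (h.le_one hC)
    have h7 : 3 / Real.sqrt (gammaHat C) =
        2 / Real.sqrt (gammaHat C) + 1 / Real.sqrt (gammaHat C) := by ring
    linarith
  have h8 : 0 ≤ Real.logb 2 C.card := h3.trans' (by positivity)
  calc _ ≤ Real.logb 2 C.card * (r * (4 * (3 / Real.sqrt (gammaHat C)))) := by gcongr
    _ = _ := by ring

/-! ### Correctness -/

theorem mem_nextCandidates {n : ℕ} {S : Finset (Concept n)} {c : Concept n} (hc : c ∈ S)
    (res : Option (Input n))
    (h : innerError (greedyInputs (columnFlip (flipSet S) S)) (flipConcept (flipSet S) c) res = 0) :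
    c ∈ nextCandidates S res := by
  have h1 : flipConcept (flipSet S) c ∈ columnFlip (flipSet S) S :=
    Finset.mem_image_of_mem _ hc
  cases res with
  | some a =>
    refine Finset.mem_image.mpr ⟨_, Finset.mem_filter.mpr ⟨h1, ?_⟩, flipConcept_flipConcept _ c⟩
    by_contra h'
    simp only [innerError, if_neg h'] at h
    norm_num at h
  | none =>
    refine Finset.mem_image.mpr ⟨_, Finset.mem_filter.mpr ⟨h1, ?_⟩, flipConcept_flipConcept _ c⟩
    by_contra h'
    simp only [innerError, if_neg h'] at h
    norm_num at h

theorem innerError_eq {n : ℕ} (I : Finset (Input n)) (c : Concept n) (res : Option (Input n)) :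
    innerError I c res = 0 ∨ innerError I c res = 1 := by
  cases res <;> unfold innerError <;> dsimp only <;> split_ifs <;> simp

theorem soleConcept_eq {n : ℕ} {S : Finset (Concept n)} {c : Concept n} (hc : c ∈ S)
    (hS : S.card ≤ 1) : soleConcept S = c := by
  have hne : S.Nonempty := ⟨c, hc⟩
  rw [soleConcept, dif_pos hne]
  exact Finset.card_le_one.mp hS _ hne.choose_spec _ hc

open Classical in
-- A union bound over the rounds. Here the fuel matters: `htk` ensures that the loop does not stop
-- before a single candidate is left.
theorem expect_outerLoop_error_le {n : ℕ} {γ : ℝ} (hγ : 0 < γ) {S : Finset (Concept n)}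
    (h : SplitBound γ S) (r k t : ℕ) (ht : S.card < 2 ^ (t + 1)) (htk : t ≤ k)
    {c : Concept n} (hc : c ∈ S) :
    (outerLoop r k S).expect c (fun g => if g = circuitFor c then 0 else 1) ≤
      t * (1 / 2) ^ r := by
  have hret : S.card ≤ 1 → (Procedure.ret (n := n) (circuitFor (soleConcept S))).expect c
      (fun g => if g = circuitFor c then 0 else 1) = 0 := by
    intro hS
    rw [soleConcept_eq hc hS]
    simp [Procedure.expect]
  induction k generalizing S t with
  | zero =>
    obtain rfl : t = 0 := by omega
    rw [outerLoop, hret (by omega)]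
    simp
  | succ k ih =>
    by_cases hS : S.card ≤ 1
    · rw [outerLoop, if_pos hS, hret hS]
      positivity
    · have hS2 : 2 ≤ S.card := by omega
      cases t with
      | zero => omega
      | succ t =>
        rw [outerLoop_succ r k hS2, Procedure.expect_bind, Procedure.expect_simulate]
        set I := greedyInputs (columnFlip (flipSet S) S)
        set c' := flipConcept (flipSet S) c
        -- A correct round keeps `c` and leaves the error of the remaining `t` rounds; after a wrong
        -- one the trivial bound 1 is used.
        calc _ ≤ (innerLoop I r).expect c'
              (fun res => innerError I c' res + t * (1 / 2) ^ r) := by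
              refine Procedure.expect_mono _ _ fun res => ?_
              have hcard := card_nextCandidates_le hγ hS2 h res
              rcases innerError_eq I c' res with h0 | h1
              · rw [h0, zero_add]
                have hmem := mem_nextCandidates hc res h0
                refine ih (h.mono (nextCandidates_subset S res)) t ?_ (by omega) hmem ?_
                · rw [pow_succ] at ht
                  omega
                · intro hS
                  rw [soleConcept_eq hmem hS]
                  simp [Procedure.expect]
              · rw [h1]
                refine (Procedure.expect_mono c _ (h := fun _ => 1) fun g => ?_).trans ?_
                · split_ifs <;> norm_num
                · rw [Procedure.expect_const]
                  have : (0 : ℝ) ≤ t * (1 / 2) ^ r := by positivity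
                  linarith
          _ ≤ (1 / 2) ^ r + t * (1 / 2) ^ r := by
              rw [Procedure.expect_add, Procedure.expect_const]
              gcongr
              exact expect_innerLoop_error_le I c' r
          _ = _ := by push_cast; ring

theorem two_thirds_le_prob {n : ℕ} {C : Finset (Concept n)} (hC : 2 ≤ C.card) {c : Concept n}
    (hc : c ∈ C) : 2 / 3 ≤ (learningAlgorithm C).prob c (circuitFor c) := by
  classical
  set r := ⌈Real.logb 2 (3 * Real.logb 2 C.card)⌉₊ with hr
  have hlog : 0 < Real.logb 2 C.card :=
    Real.logb_pos (by norm_num) (by exact_mod_cast (by omega : 1 < C.card))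
  have h1 := expect_outerLoop_error_le (gammaHat_pos hC) (splitBound_gammaHat C) r C.card
    (Nat.log 2 C.card) (Nat.lt_pow_succ_log_self (by norm_num) _) (Nat.log_le_self _ _) hc
  have h2 : (Nat.log 2 C.card : ℝ) * (1 / 2) ^ r ≤ 1 / 3 := by
    have h3 : (Nat.log 2 C.card : ℝ) ≤ Real.logb 2 C.card := by
      exact_mod_cast Real.natLog_le_logb C.card 2
    have h4 : 3 * Real.logb 2 C.card ≤ 2 ^ r := by
      have h5 : Real.logb 2 (3 * Real.logb 2 C.card) ≤ r := Nat.le_ceil _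
      have := (Real.logb_le_iff_le_rpow (by norm_num) (by positivity)).mp h5
      exact_mod_cast this
    rw [one_div_pow, mul_one_div, div_le_div_iff₀ (by positivity) (by norm_num)]
    linarith
  have h6 : (learningAlgorithm C).prob c (circuitFor c) = 1 - (learningAlgorithm C).expect c
      (fun g => if g = circuitFor c then 0 else 1) := by
    rw [Procedure.prob_eq_expect, ← Procedure.expect_one_sub]
    congr 1
    ext g
    split_ifs <;> norm_num
  rw [h6]
  change (learningAlgorithm C).expect c _ ≤ _ at h1
  linarith

/-! ### Blocks of unitaries and oracles -/

section Compose

variable {n : ℕ} (d : ℕ) (e : Basis n d → ℕ)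

/-- Configurations of a circuit with workspace `d + 1` followed, after the outcome `z`, by a
circuit with workspace `e z + 1`. -/
abbrev SeqIndex : Type := Basis n d ⊕ (Σ z : Basis n d, Basis n (e z))

instance : DecidableEq (Σ z : Basis n d, Basis n (e z)) := inferInstance

instance : DecidableEq (SeqIndex d e) := instDecidableEqSum

/-- The label of the distinguished element is arranged to be 0 so that the composed circuit begins
in the prescribed start state. -/
theorem exists_workspace (W : Type) [Fintype W] (w₀ : W) :
    ∃ (D : ℕ) (f : W ≃ Fin (D + 1)), f w₀ = 0 := by
  have : Nonempty W := ⟨w₀⟩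
  obtain ⟨D, hD⟩ := Nat.exists_eq_succ_of_ne_zero (Fintype.card_ne_zero (α := W))
  let f := Fintype.equivFinOfCardEq hD
  exact ⟨D, f.trans (Equiv.swap (f w₀) 0), by simp⟩

/-- The identification of configurations with basis states, given that of the workspace. -/
def seqEquiv {D : ℕ} (f : (Fin (d + 1) ⊕ (Σ z : Basis n d, Fin (e z + 1))) ≃ Fin (D + 1)) :
    SeqIndex d e ≃ Basis n D where
  toFun
    | .inl (x, b, w) => (x, b, f (.inl w))
    | .inr ⟨z, (x, b, w)⟩ => (x, b, f (.inr ⟨z, w⟩))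
  invFun y := match f.symm y.2.2 with
    | .inl w => .inl (y.1, y.2.1, w)
    | .inr ⟨z, w⟩ => .inr ⟨z, (y.1, y.2.1, w)⟩
  left_inv s := by
    rcases s with ⟨x, b, w⟩ | ⟨z, x, b, w⟩ <;> simp
  right_inv y := by
    rcases y with ⟨x, b, w⟩
    rcases h : f.symm w with w' | ⟨z, w'⟩ <;> simp only [h, Prod.mk.injEq, true_and] <;>
      rw [← h, f.apply_symm_apply]

/-- Exchange the outcome `z` with the start of the circuit that follows it. -/
def seqSwap : SeqIndex d e → SeqIndex d e
  | .inl z => .inr ⟨z, ((fun _ => false), false, 0)⟩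
  | .inr ⟨z, s⟩ => if s = ((fun _ => false), false, 0) then .inl z else .inr ⟨z, s⟩

theorem seqSwap_involutive : Function.Involutive (seqSwap d e) := by
  rintro (z | ⟨z, s⟩)
  · simp [seqSwap]
  · by_cases h : s = ((fun _ => false), false, 0) <;> simp [seqSwap, h]

/-- The exchange as a unitary matrix. -/
def seqSwapUnitary : Matrix.unitaryGroup (SeqIndex d e) ℂ :=
  ⟨(seqSwap_involutive d e).toPerm.permMatrix ℂ, by
    rw [Matrix.mem_unitaryGroup_iff', Matrix.star_eq_conjTranspose,
      Matrix.conjTranspose_permMatrix, ← Matrix.permMatrix_mul]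
    simp⟩

variable {d e}

theorem seqSwapUnitary_mulVec (f : SeqIndex d e → ℂ) (s : SeqIndex d e) :
    ((seqSwapUnitary d e).1 *ᵥ f) s = f (seqSwap d e s) := by
  simp [seqSwapUnitary, Matrix.permMatrix_mulVec]

/-- The state with components `g` and `h z`. -/
def seqState (g : Basis n d → ℂ) (h : ∀ z, Basis n (e z) → ℂ) : SeqIndex d e → ℂ
  | .inl s => g s
  | .inr s => h s.1 s.2

/-- The block-diagonal unitary with blocks `X` and `Y z`. -/
def seqBlock (X : Matrix.unitaryGroup (Basis n d) ℂ)
    (Y : ∀ z, Matrix.unitaryGroup (Basis n (e z)) ℂ) : Matrix.unitaryGroup (SeqIndex d e) ℂ :=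
  ⟨Matrix.fromBlocks X.1 0 0 (Matrix.blockDiagonal' fun z => (Y z).1), by
    rw [Matrix.mem_unitaryGroup_iff, Matrix.star_eq_conjTranspose,
      Matrix.fromBlocks_conjTranspose, Matrix.fromBlocks_multiply,
      Matrix.blockDiagonal'_conjTranspose]
    simp only [Matrix.conjTranspose_zero, Matrix.mul_zero, Matrix.zero_mul, add_zero, zero_add,
      ← Matrix.blockDiagonal'_mul, ← Matrix.star_eq_conjTranspose,
      Matrix.mem_unitaryGroup_iff.mp X.2, Matrix.mem_unitaryGroup_iff.mp (Y _).2]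
    rw [← Matrix.fromBlocks_one, ← Matrix.blockDiagonal'_one]
    rfl⟩

theorem seqBlock_mulVec (X : Matrix.unitaryGroup (Basis n d) ℂ)
    (Y : ∀ z, Matrix.unitaryGroup (Basis n (e z)) ℂ) (g : Basis n d → ℂ)
    (h : ∀ z, Basis n (e z) → ℂ) :
    (seqBlock X Y).1 *ᵥ seqState g h = seqState (X.1 *ᵥ g) (fun z => (Y z).1 *ᵥ h z) := by
  change Matrix.fromBlocks X.1 0 0 (Matrix.blockDiagonal' fun z => (Y z).1) *ᵥ _ = _
  rw [Matrix.fromBlocks_mulVec]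
  simp only [Matrix.zero_mulVec, add_zero, zero_add]
  ext s
  rcases s with s | ⟨z, s⟩
  · rfl
  change (Matrix.blockDiagonal' (fun z => (Y z).1) *ᵥ fun s => h s.1 s.2) ⟨z, s⟩ =
    ((Y z).1 *ᵥ h z) s
  rw [Matrix.mulVec, dotProduct, Fintype.sum_sigma, Finset.sum_eq_single z]
  · simp [Matrix.mulVec, dotProduct]
  · intro z' _ hz'
    refine Finset.sum_eq_zero fun s' _ => ?_
    rw [Matrix.blockDiagonal'_apply_ne _ _ _ hz'.symm, zero_mul]
  · simp

/-- A unitary on configurations as a unitary on basis states. -/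
def transport {ι κ : Type} [Fintype ι] [DecidableEq ι] [Fintype κ] [DecidableEq κ] (E : ι ≃ κ)
    (V : Matrix.unitaryGroup ι ℂ) : Matrix.unitaryGroup κ ℂ :=
  ⟨V.1.submatrix E.symm E.symm, by
    rw [Matrix.mem_unitaryGroup_iff, Matrix.star_eq_conjTranspose,
      Matrix.conjTranspose_submatrix, Matrix.submatrix_mul_equiv,
      ← Matrix.star_eq_conjTranspose, Matrix.mem_unitaryGroup_iff.mp V.2,
      Matrix.submatrix_one_equiv]⟩

theorem transport_mulVec {ι κ : Type} [Fintype ι] [DecidableEq ι] [Fintype κ] [DecidableEq κ]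
    (E : ι ≃ κ) (V : Matrix.unitaryGroup ι ℂ) (f : κ → ℂ) :
    ((transport E V).1 *ᵥ f) ∘ E = V.1 *ᵥ (f ∘ E) := by
  change (V.1.submatrix E.symm E.symm *ᵥ f) ∘ E = _
  rw [Matrix.submatrix_mulVec_equiv]
  ext s
  simp

/-- The oracle acts on the query and answer registers only, which all blocks share; block labels
live in the workspace. Hence one oracle call serves all blocks at once. -/
theorem QMQ_mulVec_seqEquiv {D : ℕ}
    (f : (Fin (d + 1) ⊕ (Σ z : Basis n d, Fin (e z + 1))) ≃ Fin (D + 1)) (c : Concept n)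
    (g : Basis n d → ℂ) (h : ∀ z, Basis n (e z) → ℂ) (F : Basis n D → ℂ)
    (hF : F ∘ seqEquiv d e f = seqState g h) :
    (QMQ D c *ᵥ F) ∘ seqEquiv d e f = seqState (QMQ d c *ᵥ g) (fun z => QMQ (e z) c *ᵥ h z) := by
  ext s
  rcases s with ⟨x, b, w⟩ | ⟨z, x, b, w⟩
  · simp only [Function.comp_apply, seqState, QMQ_mulVec]
    exact congrFun hF (.inl (x, xor b (c x), w))
  · simp only [Function.comp_apply, seqState, QMQ_mulVec]
    exact congrFun hF (.inr ⟨z, (x, xor b (c x), w)⟩)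

end Compose

/-! ### Sequential composition without intermediate measurement -/

/-- Run `A`, store the outcome instead of measuring it, and run `B z` controlled on it. -/
theorem QueryCircuit.exists_sequential {n : ℕ} {α : Type} (A : QueryCircuit n)
    (B : Basis n A.work → QueryCircuit n) (T : ℕ) (hT : ∀ z, (B z).queries = T)
    (out : ∀ z, Basis n (B z).work → α) [Nonempty α] :
    ∃ (C : QueryCircuit n) (o : Basis n C.work → α), C.queries = A.queries + T ∧
      ∀ (c : Concept n) (g : α → ℝ), ∑ y, C.measure c y * g (o y) =
        ∑ z, A.measure c z * ∑ s, (B z).measure c s * g (out z s) := by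
  let d := A.work
  let e : Basis n d → ℕ := fun z => (B z).work
  obtain ⟨D, f, hf⟩ := exists_workspace
    (Fin (d + 1) ⊕ (Σ z : Basis n d, Fin (e z + 1))) (.inl 0)
  let E := seqEquiv d e f
  -- At time `A.queries` three unitaries are merged: the last one of `A`, the exchange that records
  -- the outcome, and the first ones of all `B z`.
  let V : ℕ → Matrix.unitaryGroup (SeqIndex d e) ℂ := fun t =>
    if t < A.queries then seqBlock (A.U t) (fun _ => 1)
    else if t = A.queries then
      seqBlock 1 (fun z => (B z).U 0) * (seqSwapUnitary d e * seqBlock (A.U t) (fun _ => 1))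
    else seqBlock 1 (fun z => (B z).U (t - A.queries))
  let C : QueryCircuit n := ⟨A.queries + T, D, fun t => transport E (V t)⟩
  -- the state before the unitary at time `t`
  let pre : Concept n → ℕ → Basis n D → ℂ := fun c t => match t with
    | 0 => startState n D
    | t + 1 => QMQ D c *ᵥ C.state c t
  let preA : Concept n → ℕ → Basis n d → ℂ := fun c t => match t with
    | 0 => startState n d
    | t + 1 => QMQ d c *ᵥ A.state c t
  have hC : ∀ c t, C.state c t ∘ E = (V t).1 *ᵥ (pre c t ∘ E) := by
    intro c t
    cases t with
    | zero => exact transport_mulVec E (V 0) _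
    | succ t => exact transport_mulVec E (V (t + 1)) _
  have hA : ∀ c t, A.state c t = (A.U t).1 *ᵥ preA c t := by
    intro c t
    cases t <;> rfl
  have hstart : startState n D ∘ E = seqState (startState n d) 0 := by
    have h0 : E (.inl ((fun _ => false), false, 0)) = ((fun _ => false), false, 0) := by
      simp [E, seqEquiv, hf]
    ext s
    simp only [Function.comp_apply, startState]
    rw [← h0]
    rcases s with s | s
    · simp [seqState, Pi.single_apply, E.injective.eq_iff]
    · simp [seqState, E.injective.eq_iff]
  have hblock : ∀ (t : ℕ) (g : Basis n d → ℂ),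
      (seqBlock (e := e) (A.U t) (fun _ => 1)).1 *ᵥ seqState g 0 =
        seqState ((A.U t).1 *ᵥ g) 0 := by
    intro t g
    rw [seqBlock_mulVec]
    congr 1
    funext z
    exact Matrix.mulVec_zero _
  have hpre : ∀ c t, t ≤ A.queries → pre c t ∘ E = seqState (preA c t) 0 := by
    intro c t
    induction t with
    | zero => intro _; exact hstart
    | succ t ih =>
      intro ht
      have h1 : C.state c t ∘ E = seqState (A.state c t) 0 := by
        have : V t = seqBlock (A.U t) (fun _ => 1) := if_pos (by omega)
        rw [hC, ih (by omega), this, hA, hblock]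
      refine (QMQ_mulVec_seqEquiv f c _ _ _ h1).trans ?_
      congr 1
      funext z
      exact Matrix.mulVec_zero _
  -- After the exchange, block `z` carries the state of `B z` scaled by the amplitude of `z` in `A`.
  -- Orthogonality of the blocks turns this into products of probabilities.
  have hpost : ∀ c t, C.state c (A.queries + t) ∘ E =
      seqState 0 (fun z => A.state c A.queries z • (B z).state c t) := by
    intro c t
    induction t with
    | zero =>
      have : V A.queries = seqBlock 1 (fun z => (B z).U 0) *
          (seqSwapUnitary d e * seqBlock (A.U A.queries) (fun _ => 1)) := by
        simp [V]
      rw [add_zero, hC, hpre c _ le_rfl, this]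
      change ((seqBlock 1 (fun z => (B z).U 0)).1 *
          ((seqSwapUnitary d e).1 * (seqBlock (A.U A.queries) (fun _ => 1)).1)) *ᵥ _ = _
      have h2 : (seqSwapUnitary d e).1 *ᵥ seqState (A.state c A.queries) 0 =
          seqState 0 (fun z => A.state c A.queries z • startState n (e z)) := by
        ext s
        rw [seqSwapUnitary_mulVec]
        rcases s with z | ⟨z, s⟩
        · simp [seqSwap, seqState]
        · by_cases hs : s = ((fun _ => false), false, 0) <;>
            simp [seqSwap, seqState, hs, startState]
      rw [← Matrix.mulVec_mulVec, ← Matrix.mulVec_mulVec, hblock, ← hA, h2, seqBlock_mulVec]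
      congr 1
      · exact Matrix.mulVec_zero _
      · funext z
        rw [Matrix.mulVec_smul]
        rfl
    | succ t ih =>
      have : V (A.queries + t + 1) = seqBlock 1 (fun z => (B z).U (t + 1)) := by
        simp only [V]
        rw [if_neg (by omega), if_neg (by omega)]
        have : A.queries + t + 1 - A.queries = t + 1 := by omega
        rw [this]
      have h1 := QMQ_mulVec_seqEquiv f c _ _ _ ih
      rw [← add_assoc, hC, this]
      refine (congrArg (fun F => (seqBlock 1 (fun z => (B z).U (t + 1))).1 *ᵥ F) h1).trans ?_
      rw [seqBlock_mulVec]
      congr 1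
      · rw [Matrix.mulVec_zero, Matrix.mulVec_zero]
      · funext z
        rw [Matrix.mulVec_smul, Matrix.mulVec_smul]
        rfl
  -- The first summand has amplitude 0 at the end, so its output value is arbitrary.
  let o : SeqIndex d e → α := Sum.elim (fun _ => Classical.arbitrary α) (fun s => out s.1 s.2)
  refine ⟨C, fun y => o (E.symm y), rfl, fun c g => ?_⟩
  have hm : ∀ s, C.measure c (E s) = ‖(C.state c (A.queries + T) ∘ E) s‖ ^ 2 := fun s => rfl
  refine (E.sum_comp _).symm.trans ?_
  simp only [hm, hpost, Equiv.symm_apply_apply]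
  rw [Fintype.sum_sum_type, Fintype.sum_sigma]
  simp only [seqState, Pi.zero_apply, norm_zero, ne_eq, OfNat.ofNat_ne_zero,
    not_false_eq_true, zero_pow, zero_mul, Finset.sum_const_zero, zero_add]
  refine Finset.sum_congr rfl fun z _ => ?_
  rw [Finset.mul_sum]
  refine Finset.sum_congr rfl fun s _ => ?_
  simp only [QueryCircuit.measure, hT z, Pi.smul_apply, smul_eq_mul, norm_mul, mul_pow, o,
    Sum.elim_inr, mul_assoc]

/-! ### Procedures as query circuits -/

/-- Prepare the uniform superposition of the workspace. -/
def uniformCircuit (n m : ℕ) : QueryCircuit n where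
  queries := 0
  work := m
  U _ := reflectionUnitary (startState n m - fun z =>
    if z.1 = (fun _ => false) ∧ z.2.1 = false then ((1 / Real.sqrt (m + 1) : ℝ) : ℂ) else 0)

theorem sum_ite_register {n m : ℕ} (x : Input n) (b : Bool) (F : Basis n m → ℝ) :
    ∑ z : Basis n m, (if z.1 = x ∧ z.2.1 = b then F z else 0) = ∑ i, F (x, b, i) := by
  rw [Fintype.sum_prod_type, Finset.sum_eq_single x, Fintype.sum_prod_type,
    Finset.sum_eq_single b]
  · simp
  · intro b' _ hb
    simp [hb]
  · simp
  · intro x' _ hx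
    simp [hx]
  · simp

theorem sum_measure_uniformCircuit {n m : ℕ} (c : Concept n) (F : Basis n m → ℝ) :
    ∑ z, (uniformCircuit n m).measure c z * F z =
      (∑ i, F ((fun _ => false), false, i)) / (m + 1) := by
  have hsq : (1 / Real.sqrt (m + 1)) ^ 2 = (1 : ℝ) / (m + 1) := by
    rw [div_pow, Real.sq_sqrt (by positivity), one_pow]
  have hnorm : ∀ z : Basis n m,
      ‖(if z.1 = (fun _ => false) ∧ z.2.1 = false then ((1 / Real.sqrt (m + 1) : ℝ) : ℂ)
        else 0)‖ ^ 2 = if z.1 = (fun _ => false) ∧ z.2.1 = false then (1 : ℝ) / (m + 1) else 0 := by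
    intro z
    split_ifs
    · rw [Complex.norm_real, Real.norm_eq_abs, sq_abs, hsq]
    · simp
  have hstate : (uniformCircuit n m).state c 0 = fun z =>
      if z.1 = (fun _ => false) ∧ z.2.1 = false then ((1 / Real.sqrt (m + 1) : ℝ) : ℂ) else 0 := by
    refine reflection_startState_sub _ ?_ ?_
    · rw [Finset.sum_congr rfl fun z _ => hnorm z, sum_ite_register]
      simp only [Finset.sum_const, Finset.card_univ, Fintype.card_fin, nsmul_eq_mul]
      push_cast
      field_simp
    · simp
  have hm : ∀ z, (uniformCircuit n m).measure c z =
      if z.1 = (fun _ => false) ∧ z.2.1 = false then (1 : ℝ) / (m + 1) else 0 :=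
    fun z => (congrArg (fun f => ‖f z‖ ^ 2) hstate).trans (hnorm z)
  refine (Finset.sum_congr rfl fun z _ => (congrArg (· * F z) (hm z)).trans
    (ite_zero_mul _ _ _)).trans ?_
  refine (sum_ite_register _ _ _).trans ?_
  rw [← Finset.mul_sum, one_div, inv_mul_eq_div]
  rfl

/-- Make a classical query at `x`. -/
def classicalQueryCircuit {n : ℕ} (x : Input n) : QueryCircuit n where
  queries := 1
  work := 0
  U
    | 0 => reflectionUnitary (startState n 0 - Pi.single (x, false, 0) 1)
    | _ + 1 => 1

theorem sum_measure_classicalQueryCircuit {n : ℕ} (x : Input n) (c : Concept n)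
    (F : Basis n 0 → ℝ) :
    ∑ z, (classicalQueryCircuit x).measure c z * F z = F (x, c x, 0) := by
  have h0 : (classicalQueryCircuit x).state c 0 = Pi.single (x, false, 0) 1 := by
    refine reflection_startState_sub _ ?_ ?_
    · rw [Finset.sum_eq_single (x, false, 0)]
      · simp
      · intro z _ hz
        simp [Pi.single_eq_of_ne hz]
      · simp
    · rw [Pi.single_apply]
      split_ifs <;> simp
  have h1 : ∀ z : Basis n 0, (classicalQueryCircuit x).measure c z =
      if z = (x, c x, 0) then 1 else 0 := by
    intro z
    have : (classicalQueryCircuit x).state c 1 z =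
        (Pi.single (x, false, 0) 1 : Basis n 0 → ℂ) (z.1, xor z.2.1 (c z.1), z.2.2) := by
      refine (congrFun (Matrix.one_mulVec _) z).trans ?_
      rw [h0]
      exact QMQ_mulVec c _ z
    refine (congrArg (fun a => ‖a‖ ^ 2) this).trans ?_
    rcases z with ⟨y, b, w⟩
    rw [Pi.single_apply]
    obtain rfl : w = 0 := Fin.fin_one_eq_zero w
    by_cases hy : y = x
    · subst hy
      cases b <;> cases hc : c y <;> simp
    · simp [hy]
  refine (Finset.sum_congr rfl fun z _ => (congrArg (· * F z) (h1 z)).trans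
    (ite_zero_mul _ _ _)).trans ?_
  exact (Fintype.sum_ite_eq' (x, c x, (0 : Fin 1)) fun z => 1 * F z).trans (one_mul _)

/-- The statement is for every `T ≥ P.queries` because sequential composition needs all
continuations to have the same length; in the induction the shorter ones are padded. -/
theorem Procedure.exists_queryCircuit {n : ℕ} {α : Type} [Nonempty α] (P : Procedure n α)
    (T : ℕ) (hT : P.queries ≤ T) :
    ∃ (C : QueryCircuit n) (o : Basis n C.work → α), C.queries = T ∧
      ∀ (c : Concept n) (g : α → ℝ), ∑ y, C.measure c y * g (o y) = P.expect c g := by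
  induction P generalizing T with
  | ret a =>
    -- `T` idle oracle calls; the output is constant, so the final state is irrelevant.
    refine ⟨⟨T, 0, fun _ => 1⟩, fun _ => a, rfl, fun c g => ?_⟩
    rw [← Finset.sum_mul, QueryCircuit.sum_measure, one_mul]
    rfl
  | rand m k ih =>
    choose B o hB ho using fun i => ih i T
      ((Finset.le_sup (f := fun i => (k i).queries) (Finset.mem_univ i)).trans hT)
    obtain ⟨C, o', hC, ho'⟩ := (uniformCircuit n m).exists_sequential
      (fun z => B z.2.2) T (fun z => hB z.2.2) (fun z => o z.2.2)
    refine ⟨C, o', hC.trans (zero_add T), fun c g => ?_⟩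
    rw [ho']
    refine (sum_measure_uniformCircuit c _).trans ?_
    simp only [ho]
    rfl
  | query x k ih =>
    have hT' : 1 + Finset.univ.sup (fun b => (k b).queries) ≤ T := hT
    choose B o hB ho using fun b => ih b (T - 1) (by
      have := Finset.le_sup (f := fun b => (k b).queries) (Finset.mem_univ b)
      omega)
    obtain ⟨C, o', hC, ho'⟩ := (classicalQueryCircuit x).exists_sequential
      (fun z => B z.2.1) (T - 1) (fun z => hB z.2.1) (fun z => o z.2.1)
    have h1 : (classicalQueryCircuit x).queries = 1 := rfl
    refine ⟨C, o', by omega, fun c g => ?_⟩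
    rw [ho']
    refine (sum_measure_classicalQueryCircuit x c _).trans ?_
    simp only [ho]
    rfl
  | run A k ih =>
    have hT' : A.queries + Finset.univ.sup (fun z => (k z).queries) ≤ T := hT
    choose B o hB ho using fun z => ih z (T - A.queries) (by
      have := Finset.le_sup (f := fun z => (k z).queries) (Finset.mem_univ z)
      omega)
    obtain ⟨C, o', hC, ho'⟩ := A.exists_sequential B (T - A.queries) hB o
    refine ⟨C, o', by omega, fun c g => ?_⟩
    rw [ho']
    simp only [ho]
    rfl

theorem Procedure.exists_quantumLearner {n : ℕ} (P : Procedure n (BoolCircuit n)) :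
    ∃ A : QuantumLearner n, A.queries = P.queries ∧
      ∀ (c : Concept n) (h : BoolCircuit n), A.prob c h = P.prob c h := by
  classical
  obtain ⟨C, o, hC, ho⟩ := P.exists_queryCircuit _ le_rfl
  refine ⟨⟨C, o⟩, hC, fun c h => ?_⟩
  rw [Procedure.prob_eq_expect, ← ho]
  simp only [QuantumLearner.prob, mul_ite, mul_one, mul_zero]

theorem QuantumLearner.isExactLearnerFor_of_prob {n : ℕ} (A : QuantumLearner n)
    {C : Finset (Concept n)} (h : ∀ c ∈ C, 2 / 3 ≤ A.prob c (circuitFor c)) :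
    A.IsExactLearnerFor C := by
  intro c hc
  refine (h c hc).trans (Finset.sum_le_sum fun z _ => ?_)
  by_cases h1 : A.out z = circuitFor c
  · rw [if_pos h1, if_pos]
    rw [h1, circuitFor_eval]
    exact fun _ => rfl
  · rw [if_neg h1]
    split_ifs
    · exact A.measure_nonneg c z
    · exact le_rfl

/-! ### Numerical bounds -/

theorem three_halves_le_logb_three : (3 : ℝ) / 2 ≤ Real.logb 2 3 := by
  have h : Real.logb 2 ((2 : ℝ) ^ 3) ≤ Real.logb 2 (3 ^ 2) :=
    Real.logb_le_logb_of_le (by norm_num) (by norm_num) (by norm_num)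
  rw [Real.logb_pow, Real.logb_pow, Real.logb_self_eq_one (by norm_num)] at h
  push_cast at h
  linarith

theorem logb_three_le_two : Real.logb 2 3 ≤ 2 := by
  have h : Real.logb 2 3 ≤ Real.logb 2 ((2 : ℝ) ^ 2) :=
    Real.logb_le_logb_of_le (by norm_num) (by norm_num) (by norm_num)
  rw [Real.logb_pow, Real.logb_self_eq_one (by norm_num)] at h
  push_cast at h
  linarith

/-- The rounded-up logarithm is at most log L + 3, and log L ≥ 1/2 because L² ≥ 9/4, so 3 ≤ 6 log L.
At L = 1 the right side vanishes, which is why |C| = 2 is treated apart. -/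
theorem repetitions_le {L : ℝ} (hL : 3 / 2 ≤ L) :
    (⌈Real.logb 2 (3 * L)⌉₊ : ℝ) ≤ 7 * Real.logb 2 L := by
  have h1 : (1 : ℝ) / 2 ≤ Real.logb 2 L := by
    have h : Real.logb 2 2 ≤ Real.logb 2 (L ^ 2) :=
      Real.logb_le_logb_of_le (by norm_num) (by norm_num) (by nlinarith)
    rw [Real.logb_pow, Real.logb_self_eq_one (by norm_num)] at h
    push_cast at h
    linarith
  have h2 : Real.logb 2 (3 * L) = Real.logb 2 3 + Real.logb 2 L :=
    Real.logb_mul (by norm_num) (by linarith)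
  have h3 := Nat.ceil_lt_add_one (a := Real.logb 2 (3 * L)) (by
    rw [h2]
    linarith [three_halves_le_logb_three])
  linarith [logb_three_le_two]

theorem queries_le_of_three_le {n : ℕ} {C : Finset (Concept n)} (hC : 3 ≤ C.card) :
    ((learningAlgorithm C).queries : ℝ) ≤
      84 * (Real.logb 2 C.card * Real.logb 2 (Real.logb 2 C.card) /
        Real.sqrt (gammaHat C)) := by
  have hL : 3 / 2 ≤ Real.logb 2 C.card :=
    three_halves_le_logb_three.trans
      (Real.logb_le_logb_of_le (by norm_num) (by norm_num) (by exact_mod_cast hC))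
  refine (queries_learningAlgorithm_le (by omega)).trans ?_
  have h0 : 0 ≤ Real.logb 2 C.card := by linarith
  calc _ ≤ 12 * (Real.logb 2 C.card * (7 * Real.logb 2 (Real.logb 2 C.card)) /
        Real.sqrt (gammaHat C)) := by
        gcongr
        exact repetitions_le hL
    _ = _ := by ring

theorem queries_le_of_card_eq_two {n : ℕ} {C : Finset (Concept n)} (hC : C.card = 2) :
    ((learningAlgorithm C).queries : ℝ) ≤ 84 := by
  refine (queries_learningAlgorithm_le hC.ge).trans ?_
  have h1 := one_div_card_le_gammaHat hC.ge
  rw [hC] at h1 ⊢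
  push_cast at h1 ⊢
  -- For |C| = 2 the parameter is at least 1/2, and 1/4 ≤ 1/2 suffices for the root; the total is
  -- then 12 · 2 · 2 = 48.
  have h2 : (1 : ℝ) / 2 ≤ Real.sqrt (gammaHat C) := Real.le_sqrt_of_sq_le (by linarith)
  have h3 : (⌈Real.logb 2 3⌉₊ : ℝ) ≤ 2 := by
    have : ⌈Real.logb 2 3⌉₊ ≤ 2 := Nat.ceil_le.mpr (by simpa using logb_three_le_two)
    exact (Nat.cast_le (α := ℝ)).mpr this
  rw [Real.logb_self_eq_one (by norm_num), mul_one, one_mul]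
  calc 12 * ((⌈Real.logb 2 3⌉₊ : ℝ) / Real.sqrt (gammaHat C)) ≤ 12 * (2 / (1 / 2)) := by gcongr
    _ ≤ 84 := by norm_num

end QuantumLearning

end

theorem theorem1 :
    ∃ K : ℝ, 0 < K ∧
      ∀ (n : ℕ) (C : Finset (QuantumLearning.Concept n)), 2 ≤ C.card →
        ((3 ≤ C.card →
            ((QuantumLearning.learningAlgorithm C).queries : ℝ) ≤
              K * (Real.logb 2 C.card * Real.logb 2 (Real.logb 2 C.card) /
                Real.sqrt (QuantumLearning.gammaHat C))) ∧
          (C.card = 2 → ((QuantumLearning.learningAlgorithm C).queries : ℝ) ≤ K) ∧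
          ∃ A : QuantumLearning.QuantumLearner n,
            A.queries = (QuantumLearning.learningAlgorithm C).queries ∧
            (∀ (c : QuantumLearning.Concept n) (h : QuantumLearning.BoolCircuit n),
              A.prob c h = (QuantumLearning.learningAlgorithm C).prob c h) ∧
            A.IsExactLearnerFor C) := by
  refine ⟨84, by norm_num, fun n C hC => ⟨QuantumLearning.queries_le_of_three_le,
    QuantumLearning.queries_le_of_card_eq_two, ?_⟩⟩
  obtain ⟨A, hq, hp⟩ := (QuantumLearning.learningAlgorithm C).exists_quantumLearner
  refine ⟨A, hq, hp, A.isExactLearnerFor_of_prob fun c hc => ?_⟩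
  rw [hp]
  exact QuantumLearning.two_thirds_le_prob hC hc
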